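/- Let $n_x,n_y$ be dimensions, $A\in\mathbb R^{n_x\times n_x}$, $C\in\mathbb R^{n_y\times n_x}$ with $(A,C)$ observable. Let $\hat\Sigma_w\succ0$, $\hat\Sigma_v\succ0$, $\hat\Sigma_{x,0}^-\succ0$ be the nominal covariances of the process noise, the measurement noise and the initial state (the nominal distributions being Gaussian and stationary), and let $\theta_w,\theta_v,\theta_{x_0}\ge0$ be radii. Write $\Psi(\Sigma^-,V)=\Sigma^--\Sigma^-C^\top(C\Sigma^-C^\top+V)^{-1}C\Sigma^-$, and for a nominal covariance $\hat X$ and radius $\theta$ let $\mathcal A(\hat X,\theta)$ be the set of $X\succeq0$ with $X\succeq\lambda_{\min}(\hat X)I$ and $\operatorname{Tr}[X+\hat X-2(\hat X^{1/2}X\hat X^{1/2})^{1/2}]\le\theta^2$. *Distributionally robust Kalman filter (DRKF).* A DRKF is given by sequences with: $(\Sigma_{x,0}^-,V_0)$ maximizes $\operatorname{Tr}\Psi(\Sigma^-,V)$ over $\mathcal A(\hat\Sigma_{x,0}^-,\theta_{x_0})\times\mathcal A(\hat\Sigma_v,\theta_v)$; and for every $t\ge0$, $\Sigma_{x,t}=\Psi(\Sigma_{x,t}^-,V_t)$,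 $(W_t,V_{t+1})$ maximizes $\operatorname{Tr}\Psi(A\Sigma_{x,t}A^\top+W,V)$ over $\mathcal A(\hat\Sigma_w,\theta_w)\times\mathcal A(\hat\Sigma_v,\theta_v)$, and $\Sigma_{x,t+1}^-=A\Sigma_{x,t}A^\top+W_t$. A pair $(\Sigma^-,\Sigma)$ with $\Sigma^-\succeq0$ is a fixed point of the DRKF recursion if $\Sigma^-=A\Sigma A^\top+W$ and $\Sigma=\Psi(\Sigma^-,V)$ for some maximizer $(W,V)$ of $\operatorname{Tr}\Psi(A\Sigma A^\top+W',V')$ over $(W',V')\in\mathcal A(\hat\Sigma_w,\theta_w)\times\mathcal A(\hat\Sigma_v,\theta_v)$. *Stationary SDP.* Maximize $\operatorname{Tr}\Sigma$ over $(\Sigma^-,\Sigma,W,V,Y,Z)$ with $\Sigma^-,\Sigma,W,V\succeq0$, $Y\in\mathbb R^{n_x\times n_x}$, $Z\in\mathbb R^{n_y\times n_y}$, subject to $\Sigma^-=A\Sigma A^\top+W$, $$\begin{bmatrix}\Sigma^--\Sigma&\Sigma^-C^\top\\ C\Sigma^-&C\Sigma^-C^\top+V\end{bmatrix}\succeq0,\quad\begin{bmatrix}\hat\Sigma_w&Y\\Y^\top&W\end{bmatrix}\succeq0,\quad\begin{bmatrix}\hat\Sigma_v&Z\\Z^\top&V\end{bmatrix}\succeq0,$$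 $\operatorname{Tr}[W+\hat\Sigma_w-2Y]\le\theta_w^2$, $\operatorname{Tr}[V+\hat\Sigma_v-2Z]\le\theta_v^2$, $W\succeq\lambda_{\min}(\hat\Sigma_w)I$, $V\succeq\lambda_{\min}(\hat\Sigma_v)I$. *Bounding filters.* The lower-bound (upper-bound) classical Kalman filter is the recursion $S_t=\Psi(S_t^-,vI)$, $S_{t+1}^-=AS_tA^\top+wI$, $S_0^-=xI$, with $(w,v,x)=(\lambda_{\min}(\hat\Sigma_w),\lambda_{\min}(\hat\Sigma_v),\lambda_{\min}(\hat\Sigma_{x,0}^-))$ (respectively $(\overline\lambda(\hat\Sigma_w,\theta_w),\overline\lambda(\hat\Sigma_v,\theta_v),\overline\lambda(\hat\Sigma_{x,0}^-,\theta_{x_0}))$, where $\overline\lambda(\hat X,\theta)=(\sqrt{\lambda_{\max}(\hat X)}+\theta)^2$). **Statement.** The prior and posterior covariances of the lower- and upper-bound filters converge, to limits $(\underline\Sigma_{x,\infty}^-,\underline\Sigma_{x,\infty})$ and $(\overline\Sigma_{x,\infty}^-,\overline\Sigma_{x,\infty})$, and each of these pairs is the unique steady state, with positive semidefinite prior covariance,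 of the corresponding recursion. Every steady-state pair $(\Sigma_{x,\infty}^-,\Sigma_{x,\infty})$ of prior and posterior DRKF covariances satisfies, in the Loewner order, $$\underline\Sigma_{x,\infty}^-\preceq\Sigma_{x,\infty}^-\preceq\overline\Sigma_{x,\infty}^-,\qquad\underline\Sigma_{x,\infty}\preceq\Sigma_{x,\infty}\preceq\overline\Sigma_{x,\infty},$$ and this holds in each of the following senses of "steady-state": (i) $(\Sigma_{x,\infty}^-,\Sigma_{x,\infty})$ is the limit of the covariances $(\Sigma_{x,t}^-,\Sigma_{x,t})$ of a DRKF or, more generally, an accumulation point of this sequence; (ii) it is a fixed point of the DRKF recursion; (iii) it consists of the blocks $(\Sigma^-,\Sigma)$ of an optimal solution of the stationary SDP. Moreover, a DRKF exists, the covariance sequence of every DRKF has an accumulation point, and the stationary SDP has an optimal solution. -/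

import Mathlib

open Filter Topology Matrix
open scoped MatrixOrder

noncomputable section

namespace DRKF

/-- Smallest eigenvalue of a symmetric matrix. -/
def lamMin {n : ℕ} (X : Matrix (Fin n) (Fin n) ℝ) : ℝ := sInf (spectrum ℝ X)

/-- Largest eigenvalue of a symmetric matrix. -/
def lamMax {n : ℕ} (X : Matrix (Fin n) (Fin n) ℝ) : ℝ := sSup (spectrum ℝ X)

/-- Upper end of the eigenvalue tube, `(√λ_max(X) + θ)²`. -/
def lamBar {n : ℕ} (X : Matrix (Fin n) (Fin n) ℝ) (θ : ℝ) : ℝ := (√(lamMax X) + θ) ^ 2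

/-- Squared Bures-Wasserstein distance `Tr[S + T - 2 (T^½ S T^½)^½]` of positive semidefinite
matrices. -/
def buresSq {n : ℕ} (S T : Matrix (Fin n) (Fin n) ℝ) : ℝ :=
  (S + T - (2 : ℝ) • CFC.sqrt (CFC.sqrt T * S * CFC.sqrt T)).trace

/-- The admissible covariances of one noise source with nominal covariance `T` and radius `θ`:
the Bures-Wasserstein ball together with the eigenvalue lower bound. -/
def ambiguity {n : ℕ} (T : Matrix (Fin n) (Fin n) ℝ) (θ : ℝ) : Set (Matrix (Fin n) (Fin n) ℝ) :=
  {S | S.PosSemidef ∧ buresSq S T ≤ θ ^ 2 ∧ lamMin T • (1 : Matrix (Fin n) (Fin n) ℝ) ≤ S}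

/-- The observability matrix with block rows `C, C A, …, C A ^ (nx - 1)`. -/
def obsMatrix {nx ny : ℕ} (A : Matrix (Fin nx) (Fin nx) ℝ) (C : Matrix (Fin ny) (Fin nx) ℝ) :
    Matrix (Fin nx × Fin ny) (Fin nx) ℝ :=
  Matrix.of fun p j => (C * A ^ (p.1 : ℕ)) p.2 j

/-- The pair `(A, C)` is observable. -/
def Observable {nx ny : ℕ} (A : Matrix (Fin nx) (Fin nx) ℝ) (C : Matrix (Fin ny) (Fin nx) ℝ) :
    Prop :=
  (obsMatrix A C).rank = nx

/-- Kalman gain for prior covariance `Sm` and measurement-noise covariance `V`. -/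
def gain {nx ny : ℕ} (C : Matrix (Fin ny) (Fin nx) ℝ) (V : Matrix (Fin ny) (Fin ny) ℝ)
    (Sm : Matrix (Fin nx) (Fin nx) ℝ) : Matrix (Fin nx) (Fin ny) ℝ :=
  Sm * Cᵀ * (C * Sm * Cᵀ + V)⁻¹

/-- Measurement update: posterior covariance for prior covariance `Sm` and measurement-noise
covariance `V`. -/
def posterior {nx ny : ℕ} (C : Matrix (Fin ny) (Fin nx) ℝ) (V : Matrix (Fin ny) (Fin ny) ℝ)
    (Sm : Matrix (Fin nx) (Fin nx) ℝ) : Matrix (Fin nx) (Fin nx) ℝ :=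
  Sm - Sm * Cᵀ * (C * Sm * Cᵀ + V)⁻¹ * C * Sm

theorem posterior_eq_gain {nx ny : ℕ} (C : Matrix (Fin ny) (Fin nx) ℝ)
    (V : Matrix (Fin ny) (Fin ny) ℝ) (Sm : Matrix (Fin nx) (Fin nx) ℝ) :
    posterior C V Sm = (1 - gain C V Sm * C) * Sm := by
  simp [posterior, gain, Matrix.sub_mul]

/-- State prediction: next prior covariance for posterior covariance `S` and process-noise
covariance `W`. -/
def predict {nx : ℕ} (A W S : Matrix (Fin nx) (Fin nx) ℝ) : Matrix (Fin nx) (Fin nx) ℝ :=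
  A * S * Aᵀ + W

/-- Prior error covariances of the classical Kalman filter with process and measurement noise
covariances `W`, `V` and initial prior covariance `S₀`. -/
def kfPrior {nx ny : ℕ} (A : Matrix (Fin nx) (Fin nx) ℝ) (C : Matrix (Fin ny) (Fin nx) ℝ)
    (W : Matrix (Fin nx) (Fin nx) ℝ) (V : Matrix (Fin ny) (Fin ny) ℝ)
    (S₀ : Matrix (Fin nx) (Fin nx) ℝ) : ℕ → Matrix (Fin nx) (Fin nx) ℝ
  | 0 => S₀
  | t + 1 => predict A W (posterior C V (kfPrior A C W V S₀ t))

/-- Posterior error covariances of the same classical Kalman filter. -/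
def kfPost {nx ny : ℕ} (A : Matrix (Fin nx) (Fin nx) ℝ) (C : Matrix (Fin ny) (Fin nx) ℝ)
    (W : Matrix (Fin nx) (Fin nx) ℝ) (V : Matrix (Fin ny) (Fin ny) ℝ)
    (S₀ : Matrix (Fin nx) (Fin nx) ℝ) (t : ℕ) : Matrix (Fin nx) (Fin nx) ℝ :=
  posterior C V (kfPrior A C W V S₀ t)

/-- `(Sm, S)` is a stationary pair of prior and posterior covariances of the classical Kalman
filter with noise covariances `W`, `V`. -/
structure IsKFSteadyState {nx ny : ℕ} (A : Matrix (Fin nx) (Fin nx) ℝ)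
    (C : Matrix (Fin ny) (Fin nx) ℝ) (W : Matrix (Fin nx) (Fin nx) ℝ)
    (V : Matrix (Fin ny) (Fin ny) ℝ) (Sm S : Matrix (Fin nx) (Fin nx) ℝ) : Prop where
  posSemidef : Sm.PosSemidef
  post : S = posterior C V Sm
  prior : Sm = predict A W S

/-- Data of the time-invariant distributionally robust filtering problem that determine the
covariances (the nominal means do not enter the covariance recursions). -/
structure Model (nx ny : ℕ) where
  /-- state matrix -/
  A : Matrix (Fin nx) (Fin nx) ℝ
  /-- output matrix -/
  C : Matrix (Fin ny) (Fin nx) ℝ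
  /-- nominal process-noise covariance -/
  What : Matrix (Fin nx) (Fin nx) ℝ
  /-- nominal measurement-noise covariance -/
  Vhat : Matrix (Fin ny) (Fin ny) ℝ
  /-- nominal initial prior covariance -/
  Xhat : Matrix (Fin nx) (Fin nx) ℝ
  /-- process-noise radius -/
  θw : ℝ
  /-- measurement-noise radius -/
  θv : ℝ
  /-- initial-state radius -/
  θx : ℝ

namespace Model

variable {nx ny : ℕ} (M : Model nx ny)

/-- Prior covariances of the lower-bound Kalman filter. -/
def lowPrior : ℕ → Matrix (Fin nx) (Fin nx) ℝ :=
  kfPrior M.A M.C (lamMin M.What • 1) (lamMin M.Vhat • 1) (lamMin M.Xhat • 1)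

/-- Posterior covariances of the lower-bound Kalman filter. -/
def lowPost : ℕ → Matrix (Fin nx) (Fin nx) ℝ :=
  kfPost M.A M.C (lamMin M.What • 1) (lamMin M.Vhat • 1) (lamMin M.Xhat • 1)

/-- Prior covariances of the upper-bound Kalman filter. -/
def upPrior : ℕ → Matrix (Fin nx) (Fin nx) ℝ :=
  kfPrior M.A M.C (lamBar M.What M.θw • 1) (lamBar M.Vhat M.θv • 1) (lamBar M.Xhat M.θx • 1)

/-- Posterior covariances of the upper-bound Kalman filter. -/
def upPost : ℕ → Matrix (Fin nx) (Fin nx) ℝ :=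
  kfPost M.A M.C (lamBar M.What M.θw • 1) (lamBar M.Vhat M.θv • 1) (lamBar M.Xhat M.θx • 1)

/-- `(Sm, V)` solves the initial problem: among the admissible initial prior and
measurement-noise covariances it maximizes the trace of the posterior covariance. -/
def IsInitMaximizer (Sm : Matrix (Fin nx) (Fin nx) ℝ) (V : Matrix (Fin ny) (Fin ny) ℝ) : Prop :=
  Sm ∈ ambiguity M.Xhat M.θx ∧ V ∈ ambiguity M.Vhat M.θv ∧
    ∀ Sm' ∈ ambiguity M.Xhat M.θx, ∀ V' ∈ ambiguity M.Vhat M.θv,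
      (posterior M.C V' Sm').trace ≤ (posterior M.C V Sm).trace

/-- `(W, V)` solves the stage problem that follows the posterior covariance `P`: among the
admissible noise covariances it maximizes the trace of the next posterior covariance. The prior
covariance variable of the problem is eliminated through its defining equality
`Sm = A P Aᵀ + W`. -/
def IsStageMaximizer (P W : Matrix (Fin nx) (Fin nx) ℝ) (V : Matrix (Fin ny) (Fin ny) ℝ) : Prop :=
  W ∈ ambiguity M.What M.θw ∧ V ∈ ambiguity M.Vhat M.θv ∧
    ∀ W' ∈ ambiguity M.What M.θw, ∀ V' ∈ ambiguity M.Vhat M.θv,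
      (posterior M.C V' (predict M.A W' P)).trace ≤ (posterior M.C V (predict M.A W P)).trace

/-- `Sm t`, `S t` are the prior and posterior covariances of a distributionally robust Kalman
filter, driven by the least-favorable covariances `W t`, `V t`. -/
structure IsRun (Sm S W : ℕ → Matrix (Fin nx) (Fin nx) ℝ)
    (V : ℕ → Matrix (Fin ny) (Fin ny) ℝ) : Prop where
  init : M.IsInitMaximizer (Sm 0) (V 0)
  stage : ∀ t, M.IsStageMaximizer (S t) (W t) (V (t + 1))
  post : ∀ t, S t = posterior M.C (V t) (Sm t)
  prior : ∀ t, Sm (t + 1) = predict M.A (W t) (S t)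

/-- `(Sm, S)` is a fixed point of the distributionally robust Riccati recursion: one step of the
filter started from the posterior covariance `S` returns the prior covariance `Sm` and the
posterior covariance `S`. -/
def IsFixedPoint (Sm S : Matrix (Fin nx) (Fin nx) ℝ) : Prop :=
  Sm.PosSemidef ∧ ∃ W V, M.IsStageMaximizer S W V ∧ S = posterior M.C V Sm ∧
    Sm = predict M.A W S

/-- Feasibility for the stationary semidefinite program. -/
structure SDPFeasible (Sm S W : Matrix (Fin nx) (Fin nx) ℝ) (V : Matrix (Fin ny) (Fin ny) ℝ)
    (Y : Matrix (Fin nx) (Fin nx) ℝ) (Z : Matrix (Fin ny) (Fin ny) ℝ) : Prop where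
  lmi : (fromBlocks (Sm - S) (Sm * M.Cᵀ) (M.C * Sm) (M.C * Sm * M.Cᵀ + V)).PosSemidef
  lmiW : (fromBlocks M.What Y Yᵀ W).PosSemidef
  lmiV : (fromBlocks M.Vhat Z Zᵀ V).PosSemidef
  prior : Sm = predict M.A W S
  traceW : (W + M.What - (2 : ℝ) • Y).trace ≤ M.θw ^ 2
  traceV : (V + M.Vhat - (2 : ℝ) • Z).trace ≤ M.θv ^ 2
  lowerW : lamMin M.What • (1 : Matrix (Fin nx) (Fin nx) ℝ) ≤ W
  lowerV : lamMin M.Vhat • (1 : Matrix (Fin ny) (Fin ny) ℝ) ≤ V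
  psdSm : Sm.PosSemidef
  psdS : S.PosSemidef
  psdW : W.PosSemidef
  psdV : V.PosSemidef

/-- `(Sm, S)` are the prior and posterior blocks of an optimal solution of the stationary
semidefinite program, which maximizes the trace of the posterior block. -/
def IsSDPSolution (Sm S : Matrix (Fin nx) (Fin nx) ℝ) : Prop :=
  ∃ W V Y Z, M.SDPFeasible Sm S W V Y Z ∧
    ∀ Sm' S' W' V' Y' Z', M.SDPFeasible Sm' S' W' V' Y' Z' → S'.trace ≤ S.trace

end Model

/-- `(Sm, S)` lies between `(Lm, L)` and `(Um, U)` in the Loewner order, in both components. -/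
def Sandwiched {nx : ℕ} (Lm L Um U Sm S : Matrix (Fin nx) (Fin nx) ℝ) : Prop :=
  Lm ≤ Sm ∧ Sm ≤ Um ∧ L ≤ S ∧ S ≤ U

end DRKF

end

/-! Every admissible noise covariance lies between `lamMin • 1` and `lamBar • 1`, and the Kalman
recursion is monotone in both noise covariances and in the prior. The robust covariances are
therefore trapped between the two bounding filters at every time, and the bounds pass to limits and
accumulation points.

Monotonicity holds because the posterior is a Loewner minimum, over gains, of expressions that
increase with the prior and with the measurement noise (`posterior_le`, `exists_posterior_eq`). The
same formula makes the update sublinear. Observability bounds the iterates from zero, so they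
increase to a fixed point `P`; sublinearity and positive definite process noise contract the
iterates from any `c • P` with `1 ≤ c` to `P`. A squeeze gives convergence from every initial
covariance (`exists_forall_tendsto_kfPrior`).

A fixed point, or an SDP optimum, is a steady state of an ordinary Kalman filter whose noises lie in
the tube. Starting each bounding filter at that steady state and using global convergence gives the
bounds (`IsKFSteadyState.sandwiched`). For the SDP, one must see that optimality turns the matrix
inequality into the posterior equation. The existence claims are compactness arguments. -/

namespace Matrix

/-! ### Closed Loewner order and compact order intervals. -/

section OrderTopology

variable {m n : Type*}

theorem isClosed_setOf_posSemidef [Fintype n] : IsClosed {X : Matrix n n ℝ | X.PosSemidef} := by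
  simp only [posSemidef_iff_dotProduct_mulVec, Set.ofPred_and, Set.ofPred_forall]
  refine IsClosed.inter (isClosed_eq (by fun_prop) continuous_id)
    (isClosed_iInter fun x => isClosed_le continuous_const (by fun_prop))

instance orderClosedTopology_real [Fintype n] : OrderClosedTopology (Matrix n n ℝ) where
  isClosed_le' := isClosed_setOf_posSemidef.preimage (continuous_snd.sub continuous_fst)

theorem isCompact_setOf_entries_mem_Icc (a b : Matrix m n ℝ) :
    IsCompact {X : Matrix m n ℝ | ∀ i j, X i j ∈ Set.Icc (a i j) (b i j)} := by
  have h := isCompact_univ_pi (s := fun i : m => Set.pi Set.univ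
    fun j : n => Set.Icc (a i j) (b i j)) fun i => isCompact_univ_pi fun j => isCompact_Icc
  convert! h using 1
  ext X
  exact ⟨fun h i _ j _ => h i j, fun h i j => h i trivial j trivial⟩

/-- Test the quadratic form on the sum and the difference of two basis vectors. -/
theorem PosSemidef.abs_apply_le [Fintype n] [DecidableEq n] {X : Matrix n n ℝ}
    (hX : X.PosSemidef) (i j : n) : |X i j| ≤ (X i i + X j j) / 2 := by
  have hs : X j i = X i j := by simpa using hX.isHermitian.apply i j
  have h1 := hX.dotProduct_mulVec_nonneg (Pi.single i 1 + Pi.single j 1)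
  have h2 := hX.dotProduct_mulVec_nonneg (Pi.single i 1 - Pi.single j 1)
  simp [mulVec_add, mulVec_sub, add_dotProduct, sub_dotProduct, hs] at h1 h2
  rw [abs_le]
  constructor <;> linarith

/-- The diagonal of `X - A` is squeezed between 0 and that of `B - A`, and diagonal entries control
the off-diagonal ones. -/
instance compactIccSpace_real [Fintype n] : CompactIccSpace (Matrix n n ℝ) where
  isCompact_Icc {A B} := by
    classical
    let c : Matrix n n ℝ := of fun i j => ((B - A) i i + (B - A) j j) / 2
    refine (isCompact_setOf_entries_mem_Icc (A - c) (A + c)).of_isClosed_subset isClosed_Icc ?_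
    rintro X ⟨h1, h2⟩ i j
    have h3 := abs_le.1 (PosSemidef.abs_apply_le (le_iff.1 h1) i j)
    have h4 := PosSemidef.diag_nonneg (le_iff.1 h2) (i := i)
    have h5 := PosSemidef.diag_nonneg (le_iff.1 h2) (i := j)
    simp only [sub_apply, add_apply, c, of_apply, Set.mem_Icc] at *
    constructor <;> linarith

end OrderTopology

/-! ### Congruence and scaling in the Loewner order. -/

section Congruence

variable {m n : Type*} [Fintype m] [Fintype n]

theorem mul_mul_transpose_nonneg {X : Matrix n n ℝ} (hX : 0 ≤ X) (B : Matrix m n ℝ) :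
    0 ≤ B * X * Bᵀ := by
  simpa using (hX.posSemidef.mul_mul_conjTranspose_same B).nonneg

theorem transpose_mul_mul_nonneg {X : Matrix n n ℝ} (hX : 0 ≤ X) (B : Matrix n m ℝ) :
    0 ≤ Bᵀ * X * B := by
  simpa using (hX.posSemidef.conjTranspose_mul_mul_same B).nonneg

theorem mul_mul_transpose_mono {X Y : Matrix n n ℝ} (h : X ≤ Y) (B : Matrix m n ℝ) :
    B * X * Bᵀ ≤ B * Y * Bᵀ := by
  rw [← sub_nonneg, ← Matrix.sub_mul, ← Matrix.mul_sub]
  exact mul_mul_transpose_nonneg (sub_nonneg.2 h) B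

theorem transpose_mul_mul_mono {X Y : Matrix n n ℝ} (h : X ≤ Y) (B : Matrix n m ℝ) :
    Bᵀ * X * B ≤ Bᵀ * Y * B := by
  simpa using mul_mul_transpose_mono h Bᵀ

omit [Fintype n] in
theorem transpose_eq_of_nonneg {X : Matrix n n ℝ} (hX : 0 ≤ X) : Xᵀ = X := by
  simpa using hX.posSemidef.isHermitian.eq

omit [Fintype n] in
theorem PosDef.of_le {X Y : Matrix n n ℝ} (hX : X.PosDef) (h : X ≤ Y) : Y.PosDef := by
  simpa using hX.add_posSemidef (le_iff.1 h)

omit [Fintype n] in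
theorem smul_mono_nonneg {X Y : Matrix n n ℝ} (h : X ≤ Y) {c : ℝ} (hc : 0 ≤ c) :
    c • X ≤ c • Y := by
  rw [← sub_nonneg, ← smul_sub]
  exact ((sub_nonneg.2 h).posSemidef.smul hc).nonneg

omit [Fintype n] in
theorem smul_right_mono {X : Matrix n n ℝ} (hX : 0 ≤ X) {c d : ℝ} (hc : c ≤ d) :
    c • X ≤ d • X := by
  rw [← sub_nonneg, ← sub_smul]
  exact (hX.posSemidef.smul (sub_nonneg.2 hc)).nonneg

end Congruence

end Matrix

namespace DRKF

variable {nx ny : ℕ}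

/-! ### The measurement update as a minimum over gains. -/

section Measurement

variable {C : Matrix (Fin ny) (Fin nx) ℝ} {V V' : Matrix (Fin ny) (Fin ny) ℝ}
  {X X' : Matrix (Fin nx) (Fin nx) ℝ}

theorem innovation_posDef (hX : 0 ≤ X) (hV : V.PosDef) : (C * X * Cᵀ + V).PosDef :=
  hV.posSemidef_add (mul_mul_transpose_nonneg hX C).posSemidef

/-- Completion of squares for the measurement update, in terms of the dual variables `Z`, `U`. -/
theorem posterior_complete_square (hX : 0 ≤ X) (hV : V.PosDef) {k : Type*}
    [Fintype k] (Z : Matrix (Fin nx) k ℝ) (U : Matrix (Fin ny) k ℝ) :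
    (Z - Cᵀ * U)ᵀ * X * (Z - Cᵀ * U) + Uᵀ * V * U =
      Zᵀ * posterior C V X * Z + (U - (C * X * Cᵀ + V)⁻¹ * (C * X * Z))ᵀ * (C * X * Cᵀ + V) *
        (U - (C * X * Cᵀ + V)⁻¹ * (C * X * Z)) := by
  have hM := innovation_posDef (C := C) hX hV
  have hXt := transpose_eq_of_nonneg hX
  have hMt := transpose_eq_of_nonneg hM.posSemidef.nonneg
  have hNt := transpose_eq_of_nonneg hM.inv.posSemidef.nonneg
  have hdet := (Matrix.isUnit_iff_isUnit_det _).1 hM.isUnit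
  -- Eliminating `V` in favour of the innovation covariance `M` leaves only cancellations of `M`
  -- against its inverse.
  have hVM : V = (C * X * Cᵀ + V) - C * X * Cᵀ := by abel
  unfold posterior
  generalize C * X * Cᵀ + V = M at *
  subst hVM
  have e1 : M * (M⁻¹ * (C * X * Z)) = C * X * Z := mul_nonsing_inv_cancel_left _ _ hdet
  have e2 : ∀ T : Matrix (Fin ny) k ℝ, M⁻¹ * (M * T) = T := fun T =>
    nonsing_inv_mul_cancel_left _ _ hdet
  simp only [transpose_sub, transpose_mul, transpose_transpose, hXt, hNt, Matrix.mul_sub,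
    Matrix.sub_mul, Matrix.mul_assoc] at *
  simp only [e1, e2]
  abel

theorem posterior_conj_le (hX : 0 ≤ X) (hV : V.PosDef) {k : Type*}
    [Fintype k] (Z : Matrix (Fin nx) k ℝ) (U : Matrix (Fin ny) k ℝ) :
    Zᵀ * posterior C V X * Z ≤ (Z - Cᵀ * U)ᵀ * X * (Z - Cᵀ * U) + Uᵀ * V * U := by
  rw [posterior_complete_square hX hV]
  exact le_add_of_nonneg_right
    (transpose_mul_mul_nonneg (innovation_posDef hX hV).posSemidef.nonneg _)

theorem posterior_le (hX : 0 ≤ X) (hV : V.PosDef) (U : Matrix (Fin ny) (Fin nx) ℝ) :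
    posterior C V X ≤ (1 - Cᵀ * U)ᵀ * X * (1 - Cᵀ * U) + Uᵀ * V * U := by
  simpa using posterior_conj_le (C := C) hX hV 1 U

/-- The optimal gain annihilates the square. With `posterior_le`, this exhibits the posterior as a
minimum, so an inequality follows by inserting the optimal gain of the larger side. -/
theorem exists_posterior_eq (hX : 0 ≤ X) (hV : V.PosDef) :
    ∃ U : Matrix (Fin ny) (Fin nx) ℝ,
      posterior C V X = (1 - Cᵀ * U)ᵀ * X * (1 - Cᵀ * U) + Uᵀ * V * U :=
  ⟨(C * X * Cᵀ + V)⁻¹ * (C * X * (1 : Matrix (Fin nx) (Fin nx) ℝ)), by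
    rw [posterior_complete_square hX hV, sub_self]; simp⟩

theorem posterior_nonneg (hX : 0 ≤ X) (hV : V.PosDef) : 0 ≤ posterior C V X := by
  obtain ⟨U, hU⟩ := exists_posterior_eq (C := C) hX hV
  rw [hU]
  exact add_nonneg (transpose_mul_mul_nonneg hX _)
    (transpose_mul_mul_nonneg hV.posSemidef.nonneg _)

theorem posterior_mono (hX : 0 ≤ X) (hV : V.PosDef) (hXX : X ≤ X') (hVV : V ≤ V') :
    posterior C V X ≤ posterior C V' X' := by
  obtain ⟨U, hU⟩ := exists_posterior_eq (C := C) (hX.trans hXX) (hV.of_le hVV)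
  rw [hU]
  exact (posterior_le hX hV U).trans
    (add_le_add (transpose_mul_mul_mono hXX _) (transpose_mul_mul_mono hVV _))

/-- Keep the optimal gain for `X`: the prior term scales by `c`, while the noise term, left
unscaled, is at most `c` times itself. -/
theorem posterior_smul_le (hX : 0 ≤ X) (hV : V.PosDef) {c : ℝ} (hc : 1 ≤ c) :
    posterior C V (c • X) ≤ c • posterior C V X := by
  obtain ⟨U, hU⟩ := exists_posterior_eq (C := C) hX hV
  have hc0 : 0 ≤ c := zero_le_one.trans hc
  refine (posterior_le (hX.posSemidef.smul hc0).nonneg hV U).trans ?_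
  rw [hU, smul_add]
  simp only [Matrix.mul_smul, Matrix.smul_mul]
  gcongr
  simpa using smul_right_mono (transpose_mul_mul_nonneg hV.posSemidef.nonneg U) hc

theorem continuousAt_posterior (hX : 0 ≤ X) (hV : V.PosDef) :
    ContinuousAt (fun p : Matrix (Fin ny) (Fin ny) ℝ × Matrix (Fin nx) (Fin nx) ℝ =>
      posterior C p.1 p.2) (V, X) := by
  have hdet := (Matrix.isUnit_iff_isUnit_det _).1 (innovation_posDef (C := C) hX hV).isUnit
  have hM : Continuous fun p : Matrix (Fin ny) (Fin ny) ℝ × Matrix (Fin nx) (Fin nx) ℝ =>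
      C * p.2 * Cᵀ + p.1 := by fun_prop
  have hring : ContinuousAt Ring.inverse (C * X * Cᵀ + V).det :=
    NormedRing.inverse_continuousAt hdet.unit
  have hinv := (continuousAt_matrix_inv _ hring).comp (f := fun p :
    Matrix (Fin ny) (Fin ny) ℝ × Matrix (Fin nx) (Fin nx) ℝ => C * p.2 * Cᵀ + p.1)
    (x := (V, X)) hM.continuousAt
  have hF : Continuous fun q : Matrix (Fin nx) (Fin nx) ℝ × Matrix (Fin ny) (Fin ny) ℝ =>
      q.1 - q.1 * Cᵀ * q.2 * C * q.1 := by fun_prop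
  exact hF.continuousAt.comp (continuousAt_snd.prodMk hinv)

end Measurement

section Prediction

theorem predict_nonneg {A W S : Matrix (Fin nx) (Fin nx) ℝ} (hW : 0 ≤ W) (hS : 0 ≤ S) :
    0 ≤ predict A W S :=
  add_nonneg (mul_mul_transpose_nonneg hS A) hW

theorem predict_mono {A W W' S S' : Matrix (Fin nx) (Fin nx) ℝ} (hW : W ≤ W') (hS : S ≤ S') :
    predict A W S ≤ predict A W' S' :=
  add_le_add (mul_mul_transpose_mono hS A) hW

end Prediction

end DRKF

/-! ### Monotone convergence and squeezing in the Loewner order. -/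

namespace Matrix

variable {n : Type*} [Fintype n]

/-- In a compact order interval it suffices that cluster points are unique. Each cluster point
dominates every term, hence every other cluster point; antisymmetry concludes. -/
theorem exists_tendsto_of_monotone_le {u : ℕ → Matrix n n ℝ} (hu : Monotone u) {B : Matrix n n ℝ}
    (hB : ∀ k, u k ≤ B) : ∃ P, Tendsto u atTop (𝓝 P) := by
  have hmem : ∀ k, u k ∈ Set.Icc (u 0) B := fun k => ⟨hu k.zero_le, hB k⟩
  have key : ∀ x y, MapClusterPt x atTop u → MapClusterPt y atTop u → x ≤ y := by
    intro x y hx hy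
    obtain ⟨F, hF, hFx⟩ := mapClusterPt_iff_ultrafilter.1 hx
    obtain ⟨G, hG, hGy⟩ := mapClusterPt_iff_ultrafilter.1 hy
    refine le_of_tendsto' hFx fun k => ge_of_tendsto hGy ?_
    exact hG ((eventually_ge_atTop k).mono fun j hj => hu hj)
  obtain ⟨P, -, hP⟩ := (isCompact_Icc (a := u 0) (b := B)).exists_mapClusterPt (f := atTop) (u := u)
    (tendsto_principal.2 (Eventually.of_forall hmem))
  exact ⟨P, isCompact_Icc.tendsto_nhds_of_unique_mapClusterPt (Eventually.of_forall hmem)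
    fun x _ hx => le_antisymm (key x P hx hP) (key P x hP hx)⟩

theorem tendsto_of_tendsto_of_le_of_le_of_mem_Icc {u lo hi : ℕ → Matrix n n ℝ}
    {P a b : Matrix n n ℝ}
    (hlo : Tendsto lo atTop (𝓝 P)) (hhi : Tendsto hi atTop (𝓝 P)) (h1 : ∀ k, lo k ≤ u k)
    (h2 : ∀ k, u k ≤ hi k) (hmem : ∀ k, u k ∈ Set.Icc a b) : Tendsto u atTop (𝓝 P) := by
  refine isCompact_Icc.tendsto_nhds_of_unique_mapClusterPt (Eventually.of_forall hmem) ?_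
  intro x _ hx
  obtain ⟨F, hF, hFx⟩ := mapClusterPt_iff_ultrafilter.1 hx
  exact le_antisymm (le_of_tendsto_of_tendsto' hFx (hhi.mono_left hF) h2)
    (le_of_tendsto_of_tendsto' (hlo.mono_left hF) hFx h1)

end Matrix

namespace DRKF

/-! ### Extreme eigenvalues as Loewner bounds. -/

section Eigenvalues

variable {n : ℕ} {T S : Matrix (Fin n) (Fin n) ℝ}

theorem finite_spectrum (hT : T.IsHermitian) : (spectrum ℝ T).Finite := by
  rw [hT.spectrum_real_eq_range_eigenvalues]
  exact Set.finite_range _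

theorem lamMin_smul_one_le (hT : T.IsHermitian) : lamMin T • (1 : Matrix (Fin n) (Fin n) ℝ) ≤ T := by
  rw [← Algebra.algebraMap_eq_smul_one, algebraMap_le_iff_le_spectrum (a := T) hT]
  exact fun x hx => csInf_le (finite_spectrum hT).bddBelow hx

theorem le_lamMax_smul_one (hT : T.IsHermitian) : T ≤ lamMax T • (1 : Matrix (Fin n) (Fin n) ℝ) := by
  rw [← Algebra.algebraMap_eq_smul_one, le_algebraMap_iff_spectrum_le (a := T) hT]
  exact fun x hx => le_csSup (finite_spectrum hT).bddAbove hx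

theorem lamMin_pos [Nonempty (Fin n)] (hT : T.PosDef) : 0 < lamMin T := by
  have hs := hT.isHermitian.spectrum_real_eq_range_eigenvalues
  have hmem : lamMin T ∈ spectrum ℝ T :=
    (hs ▸ Set.range_nonempty _ : (spectrum ℝ T).Nonempty).csInf_mem
      (finite_spectrum hT.isHermitian)
  rw [hs] at hmem
  obtain ⟨i, hi⟩ := hmem
  exact hi ▸ hT.eigenvalues_pos i

theorem lamMin_smul_one_posDef (hT : T.PosDef) :
    (lamMin T • (1 : Matrix (Fin n) (Fin n) ℝ)).PosDef := by
  -- In dimension zero the spectrum is empty and `lamMin` has the default value 0, but all matrices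
  -- coincide.
  rcases isEmpty_or_nonempty (Fin n) with h | h
  · rwa [Subsingleton.elim (lamMin T • (1 : Matrix (Fin n) (Fin n) ℝ)) T]
  · exact PosDef.one.smul (lamMin_pos hT)

theorem exists_le_smul (hT : T.PosDef) (hS : S.IsHermitian) : ∃ c : ℝ, 1 ≤ c ∧ S ≤ c • T := by
  rcases isEmpty_or_nonempty (Fin n) with h | h
  · exact ⟨1, le_rfl, (Subsingleton.elim _ _).le⟩
  · have hpos := lamMin_pos hT
    refine ⟨max 1 (lamMax S / lamMin T), le_max_left _ _, (le_lamMax_smul_one hS).trans ?_⟩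
    calc lamMax S • (1 : Matrix (Fin n) (Fin n) ℝ)
        = (lamMax S / lamMin T) • lamMin T • (1 : Matrix (Fin n) (Fin n) ℝ) := by
          rw [smul_smul, div_mul_cancel₀ _ hpos.ne']
      _ ≤ max 1 (lamMax S / lamMin T) • lamMin T • (1 : Matrix (Fin n) (Fin n) ℝ) :=
          smul_right_mono (lamMin_smul_one_posDef hT).posSemidef.nonneg (le_max_right _ _)
      _ ≤ max 1 (lamMax S / lamMin T) • T :=
          smul_mono_nonneg (lamMin_smul_one_le hT.isHermitian) (zero_le_one.trans (le_max_left _ _))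

end Eigenvalues

/-! ### Global convergence of the Riccati recursion. -/

section Riccati

variable {nx ny : ℕ} {A : Matrix (Fin nx) (Fin nx) ℝ} {C : Matrix (Fin ny) (Fin nx) ℝ}
  {Q Q' X X' : Matrix (Fin nx) (Fin nx) ℝ} {R R' : Matrix (Fin ny) (Fin ny) ℝ}

theorem kfPrior_succ (t : ℕ) :
    kfPrior A C Q R X (t + 1) = predict A Q (posterior C R (kfPrior A C Q R X t)) := rfl

theorem kfPrior_add (s t : ℕ) :
    kfPrior A C Q R X (s + t) = kfPrior A C Q R (kfPrior A C Q R X s) t := by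
  induction t with
  | zero => rfl
  | succ t ih => rw [← add_assoc, kfPrior_succ, ih, kfPrior_succ]

theorem kfPrior_nonneg (hQ : 0 ≤ Q) (hR : R.PosDef) (hX : 0 ≤ X) (t : ℕ) :
    0 ≤ kfPrior A C Q R X t := by
  induction t with
  | zero => exact hX
  | succ t ih => exact predict_nonneg hQ (posterior_nonneg ih hR)

theorem kfPrior_mono (hQ : 0 ≤ Q) (hR : R.PosDef) (hX : 0 ≤ X) (hQQ : Q ≤ Q') (hRR : R ≤ R')
    (hXX : X ≤ X') (t : ℕ) : kfPrior A C Q R X t ≤ kfPrior A C Q' R' X' t := by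
  induction t with
  | zero => exact hXX
  | succ t ih =>
    exact predict_mono hQQ (posterior_mono (kfPrior_nonneg hQ hR hX t) hR ih hRR)

/-- If the dual system can be steered from `Z` to the origin in `m` steps, then `m` Riccati steps
bound the prior covariance along `Z` independently of the initial covariance. -/
theorem exists_kfPrior_conj_le (hQ : 0 ≤ Q) (hR : R.PosDef) (m : ℕ)
    (U : ℕ → Matrix (Fin ny) (Fin nx) ℝ) (Z : Matrix (Fin nx) (Fin nx) ℝ)
    (h : Aᵀ ^ m * Z = ∑ i ∈ Finset.range m, Aᵀ ^ i * Cᵀ * U i) :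
    ∃ B, ∀ X, 0 ≤ X → Zᵀ * kfPrior A C Q R X m * Z ≤ B := by
  induction m generalizing Z with
  -- The empty sum forces `Z = 0`, so the initial covariance drops out.
  | zero => exact ⟨0, fun X _ => by simp_all⟩
  | succ m ih =>
    -- The dual system runs backwards in time: the last Riccati step consumes the input `U m`, the
    -- one with the highest power of `Aᵀ`.
    obtain ⟨B, hB⟩ := ih (Aᵀ * Z - Cᵀ * U m) (by
      rw [Finset.sum_range_succ, pow_succ, Matrix.mul_assoc] at h
      rw [Matrix.mul_sub, h, ← Matrix.mul_assoc, add_sub_cancel_right])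
    refine ⟨B + (U m)ᵀ * R * U m + Zᵀ * Q * Z, fun X hX => ?_⟩
    have hconj := posterior_conj_le (C := C) (kfPrior_nonneg (A := A) (C := C) hQ hR hX m) hR
      (Aᵀ * Z) (U m)
    rw [kfPrior_succ, predict, Matrix.mul_add, Matrix.add_mul]
    refine add_le_add_left (le_trans (le_of_eq ?_)
      (hconj.trans (add_le_add_left (hB X hX) _))) _
    simp only [transpose_mul, transpose_transpose, Matrix.mul_assoc]

/-- Full column rank makes the Gram matrix `Oᵀ * O` invertible, so `O * (Oᵀ * O)⁻¹ * Z` solves `Oᵀ *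
D = Z`; its row blocks are the inputs. -/
theorem Observable.exists_sum_eq (h : Observable A C) (Z : Matrix (Fin nx) (Fin nx) ℝ) :
    ∃ U : ℕ → Matrix (Fin ny) (Fin nx) ℝ,
      Z = ∑ i ∈ Finset.range nx, Aᵀ ^ i * Cᵀ * U i := by
  set O := obsMatrix A C with hO
  have hu : IsUnit (Oᵀ * O) := by
    have hr : (Oᵀ * O).rank = nx := (Matrix.rank_transpose_mul_self O).trans h
    rw [← mulVec_surjective_iff_isUnit, ← coe_mulVecLin, ← LinearMap.range_eq_top]
    exact Submodule.eq_top_of_finrank_eq (by simpa [Matrix.rank] using hr)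
  have hdet := (Matrix.isUnit_iff_isUnit_det _).1 hu
  let D := O * ((Oᵀ * O)⁻¹ * Z)
  have hD : Oᵀ * D = Z := by
    rw [← Matrix.mul_assoc, mul_nonsing_inv_cancel_left _ _ hdet]
  refine ⟨fun i => if hi : i < nx then of fun a b => D (⟨i, hi⟩, a) b else 0, ?_⟩
  rw [Finset.sum_range, ← hD]
  ext a b
  rw [Matrix.sum_apply, Matrix.mul_apply, Fintype.sum_prod_type]
  refine Finset.sum_congr rfl fun i _ => ?_
  rw [Matrix.mul_apply]
  refine Finset.sum_congr rfl fun j _ => ?_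
  simp [hO, obsMatrix, ← transpose_pow, ← transpose_mul]

theorem exists_kfPrior_le (h : Observable A C) (hQ : 0 ≤ Q) (hR : R.PosDef) :
    ∃ B, ∀ X, 0 ≤ X → kfPrior A C Q R X nx ≤ B := by
  obtain ⟨U, hU⟩ := h.exists_sum_eq (Aᵀ ^ nx)
  obtain ⟨B, hB⟩ := exists_kfPrior_conj_le (A := A) (C := C) hQ hR nx U 1 (by simpa using hU)
  exact ⟨B, fun X hX => by simpa using hB X hX⟩

/-- The first iterate dominates the zero start, and monotonicity of the recursion propagates this
order. -/
theorem monotone_kfPrior_zero (hQ : 0 ≤ Q) (hR : R.PosDef) : Monotone (kfPrior A C Q R 0) := by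
  refine monotone_nat_of_le_succ fun k => ?_
  rw [add_comm k, kfPrior_add]
  exact kfPrior_mono hQ hR le_rfl le_rfl le_rfl (kfPrior_nonneg hQ hR le_rfl 1) k

theorem exists_tendsto_kfPrior_zero (h : Observable A C) (hQ : 0 ≤ Q) (hR : R.PosDef) :
    ∃ P, Tendsto (kfPrior A C Q R 0) atTop (𝓝 P) := by
  obtain ⟨B, hB⟩ := exists_kfPrior_le (Q := Q) h hQ hR
  refine exists_tendsto_of_monotone_le (monotone_kfPrior_zero hQ hR) (B := B) fun k => ?_
  -- The iterate at `k + nx` is `nx` steps away from a nonnegative start, so the uniform bound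
  -- applies for every `k`.
  refine (monotone_kfPrior_zero hQ hR (Nat.le_add_right k nx)).trans ?_
  rw [kfPrior_add]
  exact hB _ (kfPrior_nonneg hQ hR le_rfl k)

theorem tendsto_posterior {ι : Type*} {l : Filter ι} {u : ι → Matrix (Fin nx) (Fin nx) ℝ}
    {P : Matrix (Fin nx) (Fin nx) ℝ} (hR : R.PosDef) (hP : 0 ≤ P) (hu : Tendsto u l (𝓝 P)) :
    Tendsto (fun k => posterior C R (u k)) l (𝓝 (posterior C R P)) :=
  Tendsto.comp (g := fun p : Matrix (Fin ny) (Fin ny) ℝ × Matrix (Fin nx) (Fin nx) ℝ =>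
    posterior C p.1 p.2) (continuousAt_posterior hP hR) (tendsto_const_nhds.prodMk_nhds hu)

theorem tendsto_predict {ι : Type*} {l : Filter ι} {u : ι → Matrix (Fin nx) (Fin nx) ℝ}
    {P : Matrix (Fin nx) (Fin nx) ℝ} (hu : Tendsto u l (𝓝 P)) :
    Tendsto (fun k => predict A Q (u k)) l (𝓝 (predict A Q P)) := by
  have hc : Continuous fun X => predict A Q X := by unfold predict; fun_prop
  exact (hc.tendsto P).comp hu

theorem eq_predict_posterior_of_tendsto {P : Matrix (Fin nx) (Fin nx) ℝ} (hR : R.PosDef)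
    (hP : 0 ≤ P) (h : Tendsto (kfPrior A C Q R X) atTop (𝓝 P)) :
    P = predict A Q (posterior C R P) :=
  tendsto_nhds_unique ((tendsto_add_atTop_iff_nat 1).2 h)
    (tendsto_predict (tendsto_posterior hR hP h))

/-- Iterates started from a multiple of a fixed point contract to it, by sublinearity. -/
theorem kfPrior_smul_le {P : Matrix (Fin nx) (Fin nx) ℝ} (hQ : 0 ≤ Q) (hR : R.PosDef)
    (hP : 0 ≤ P) (hfix : P = predict A Q (posterior C R P)) {δ : ℝ} (hδ1 : δ ≤ 1)
    (hδ : δ • P ≤ Q) {c : ℝ} (hc : 1 ≤ c) (k : ℕ) :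
    kfPrior A C Q R (c • P) k ≤ (1 + (c - 1) * (1 - δ) ^ k) • P := by
  induction k with
  | zero => simp [kfPrior]
  | succ k ih =>
    have hd : 0 ≤ (c - 1) * (1 - δ) ^ k :=
      mul_nonneg (sub_nonneg.2 hc) (pow_nonneg (sub_nonneg.2 hδ1) k)
    set d := (c - 1) * (1 - δ) ^ k with hd'
    have hcP : 0 ≤ c • P := (hP.posSemidef.smul (zero_le_one.trans hc)).nonneg
    calc kfPrior A C Q R (c • P) (k + 1)
        ≤ predict A Q (posterior C R ((1 + d) • P)) := predict_mono le_rfl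
          (posterior_mono (kfPrior_nonneg hQ hR hcP k) hR ih le_rfl)
      _ ≤ predict A Q ((1 + d) • posterior C R P) :=
          predict_mono le_rfl (posterior_smul_le hP hR (by linarith))
      -- Prediction adds `Q` once, not `1 + d` times. The deficit `d • Q` is at least `d • δ • P`,
      -- which shrinks the excess by the factor `1 - δ`.
      _ = (1 + d) • predict A Q (posterior C R P) - d • Q := by
          simp only [predict, Matrix.mul_smul, Matrix.smul_mul]
          module
      _ = (1 + d) • P - d • Q := by rw [← hfix]
      _ ≤ (1 + d) • P - d • δ • P := sub_le_sub_left (smul_mono_nonneg hδ hd) _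
      _ = (1 + (c - 1) * (1 - δ) ^ (k + 1)) • P := by
          rw [pow_succ, ← mul_assoc, ← hd']
          module

/-- Global convergence of the Riccati recursion of an observable system. -/
theorem exists_forall_tendsto_kfPrior (h : Observable A C) (hQ : Q.PosDef) (hR : R.PosDef) :
    ∃ P, 0 ≤ P ∧ ∀ X, 0 ≤ X → Tendsto (kfPrior A C Q R X) atTop (𝓝 P) := by
  have hQ0 := hQ.posSemidef.nonneg
  obtain ⟨P, hP⟩ := exists_tendsto_kfPrior_zero h hQ0 hR
  have hP0 : 0 ≤ P := ge_of_tendsto' hP fun k => kfPrior_nonneg hQ0 hR le_rfl k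
  have hfix := eq_predict_posterior_of_tendsto hR hP0 hP
  have hQP : Q ≤ P := by
    rw [hfix]
    exact le_add_of_nonneg_left (mul_mul_transpose_nonneg (posterior_nonneg hP0 hR) A)
  refine ⟨P, hP0, fun X hX => ?_⟩
  -- `c` places the start below a multiple of `P`; `d` gives the contraction constant `δ = d⁻¹`.
  obtain ⟨c, hc, hXc⟩ := exists_le_smul (hQ.of_le hQP) hX.posSemidef.isHermitian
  obtain ⟨d, hd, hPd⟩ := exists_le_smul hQ hP0.posSemidef.isHermitian
  have hd0 : 0 < d := zero_lt_one.trans_le hd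
  have hδ1 : d⁻¹ ≤ 1 := inv_le_one_of_one_le₀ hd
  have hδ : d⁻¹ • P ≤ Q := by
    simpa [smul_smul, hd0.ne'] using smul_mono_nonneg hPd (inv_nonneg.2 hd0.le)
  have hup : ∀ k, kfPrior A C Q R X k ≤ (1 + (c - 1) * (1 - d⁻¹) ^ k) • P := fun k =>
    (kfPrior_mono hQ0 hR hX le_rfl le_rfl hXc k).trans
      (kfPrior_smul_le hQ0 hR hP0 hfix hδ1 hδ hc k)
  have hpow : Tendsto (fun k : ℕ => (1 + (c - 1) * (1 - d⁻¹) ^ k) • P) atTop (𝓝 P) := by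
    have h0 := tendsto_pow_atTop_nhds_zero_of_lt_one (sub_nonneg.2 hδ1)
      (sub_lt_self 1 (inv_pos.2 hd0))
    have h1 := ((h0.const_mul (c - 1)).const_add 1).smul_const P
    simpa using h1
  refine tendsto_of_tendsto_of_le_of_le_of_mem_Icc hP hpow
    (fun k => kfPrior_mono hQ0 hR le_rfl le_rfl le_rfl hX k) hup (a := 0) (b := c • P) fun k =>
      ⟨kfPrior_nonneg hQ0 hR hX k, (hup k).trans (smul_right_mono hP0 ?_)⟩
  have hp1 := pow_le_one₀ (n := k) (sub_nonneg.2 hδ1)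
    (sub_le_self 1 (inv_nonneg.2 hd0.le))
  nlinarith [mul_le_mul_of_nonneg_left hp1 (sub_nonneg.2 hc)]

theorem IsKFSteadyState.kfPrior_eq {Sm S : Matrix (Fin nx) (Fin nx) ℝ}
    (h : IsKFSteadyState A C Q R Sm S) (t : ℕ) : kfPrior A C Q R Sm t = Sm := by
  induction t with
  | zero => rfl
  | succ t ih => rw [kfPrior_succ, ih, ← h.post, ← h.prior]

theorem isKFSteadyState_iff {P : Matrix (Fin nx) (Fin nx) ℝ} (hR : R.PosDef) (hP : 0 ≤ P)
    (hconv : ∀ X, 0 ≤ X → Tendsto (kfPrior A C Q R X) atTop (𝓝 P))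
    (Sm S : Matrix (Fin nx) (Fin nx) ℝ) :
    IsKFSteadyState A C Q R Sm S ↔ Sm = P ∧ S = posterior C R P := by
  constructor
  · intro h
    have hSm : Sm = P := by
      have hlim := hconv Sm h.posSemidef.nonneg
      simp only [funext h.kfPrior_eq] at hlim
      exact tendsto_nhds_unique tendsto_const_nhds hlim
    exact ⟨hSm, hSm ▸ h.post⟩
  · rintro ⟨rfl, rfl⟩
    exact ⟨hP.posSemidef, rfl, eq_predict_posterior_of_tendsto hR hP (hconv 0 le_rfl)⟩

/-- An inequality, not an equation, is assumed because this is all that a feasible point of the SDP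
satisfies. -/
theorem le_kfPrior_of_le_predict {Sm : Matrix (Fin nx) (Fin nx) ℝ} (hR : R.PosDef)
    (hSm : 0 ≤ Sm) (h : Sm ≤ predict A Q (posterior C R Sm)) (t : ℕ) :
    Sm ≤ kfPrior A C Q R Sm t := by
  induction t with
  | zero => exact le_rfl
  | succ t ih => exact h.trans (predict_mono le_rfl (posterior_mono hSm hR ih le_rfl))

theorem kfPrior_le_of_predict_le {Sm : Matrix (Fin nx) (Fin nx) ℝ} (hQ : 0 ≤ Q) (hR : R.PosDef)
    (hSm : 0 ≤ Sm) (h : predict A Q (posterior C R Sm) ≤ Sm) (t : ℕ) :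
    kfPrior A C Q R Sm t ≤ Sm := by
  induction t with
  | zero => exact le_rfl
  | succ t ih =>
    exact (predict_mono le_rfl
      (posterior_mono (kfPrior_nonneg hQ hR hSm t) hR ih le_rfl)).trans h

end Riccati

/-! ### Eigenvalue bounds and compactness of Bures-Wasserstein balls. -/

section Ambiguity

variable {n : ℕ} {T S Y : Matrix (Fin n) (Fin n) ℝ} {θ : ℝ}

theorem le_trace_smul_one (hS : 0 ≤ S) : S ≤ S.trace • (1 : Matrix (Fin n) (Fin n) ℝ) := by
  have hH := hS.posSemidef.isHermitian
  rw [← Algebra.algebraMap_eq_smul_one, le_algebraMap_iff_spectrum_le (a := S) hH]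
  intro x hx
  rw [hH.spectrum_real_eq_range_eigenvalues] at hx
  obtain ⟨i, rfl⟩ := hx
  rw [hH.trace_eq_sum_eigenvalues]
  exact Finset.single_le_sum (f := hH.eigenvalues)
    (fun j _ => hS.posSemidef.eigenvalues_nonneg j) (Finset.mem_univ i)

theorem dotProduct_mulVec_mono {X X' : Matrix (Fin n) (Fin n) ℝ} (h : X ≤ X') (x : Fin n → ℝ) :
    x ⬝ᵥ (X *ᵥ x) ≤ x ⬝ᵥ (X' *ᵥ x) := by
  simpa [sub_mulVec, dotProduct_sub] using (le_iff.1 h).dotProduct_mulVec_nonneg x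

/-- The linear matrix inequality of the Bures-Wasserstein ball bounds the eigenvalues. -/
theorem le_lamBar_smul_one_of_fromBlocks (hT : T.IsHermitian) (hθ : 0 ≤ θ)
    (hblock : (fromBlocks T Y Yᵀ S).PosSemidef)
    (htrace : (S + T - (2 : ℝ) • Y).trace ≤ θ ^ 2) :
    S ≤ lamBar T θ • (1 : Matrix (Fin n) (Fin n) ℝ) := by
  have hS : S.PosSemidef := by
    exact hblock.submatrix (Sum.inr : Fin n → Fin n ⊕ Fin n)
  have hT' : Tᵀ = T := by simpa using hT.eq
  have hS' : Sᵀ = S := transpose_eq_of_nonneg hS.nonneg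
  have hyt : ∀ x, x ⬝ᵥ (Yᵀ *ᵥ x) = x ⬝ᵥ (Y *ᵥ x) := fun x => by
    rw [mulVec_transpose, dotProduct_comm, ← dotProduct_mulVec]
  -- If the block matrix is a joint covariance, this is the covariance of the difference of its
  -- components. The trace constraint bounds its largest eigenvalue by `θ ^ 2`.
  have hD : 0 ≤ S + T - Y - Yᵀ := by
    refine (PosSemidef.of_dotProduct_mulVec_nonneg ?_ fun x => ?_).nonneg
    · simp only [IsHermitian, conjTranspose_eq_transpose_of_trivial, transpose_sub, transpose_add,
        transpose_transpose, hT', hS']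
      abel
    · have h := hblock.dotProduct_mulVec_nonneg (Sum.elim x (-x))
      simp [fromBlocks_mulVec, mulVec_neg, hyt, sub_mulVec, add_mulVec] at h ⊢
      linarith
  have hDtr : (S + T - Y - Yᵀ).trace ≤ θ ^ 2 := by
    refine le_of_eq_of_le ?_ htrace
    simp only [trace_sub, trace_add, trace_smul, trace_transpose, smul_eq_mul]
    ring
  refine le_iff.2 (PosSemidef.of_dotProduct_mulVec_nonneg ?_ fun x => ?_)
  · exact (isHermitian_one.smul (IsSelfAdjoint.all _)).sub hS.isHermitian
  have hx0 : 0 ≤ x ⬝ᵥ x := by simpa using dotProduct_star_self_nonneg x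
  have hs0 : 0 ≤ x ⬝ᵥ (S *ᵥ x) := by simpa using hS.dotProduct_mulVec_nonneg x
  have h1 := dotProduct_mulVec_mono ((le_trace_smul_one hD).trans
    (smul_right_mono PosSemidef.one.nonneg hDtr)) x
  have h2 := dotProduct_mulVec_mono (le_lamMax_smul_one hT) x
  -- The discriminant yields the Cauchy-Schwarz inequality `y ^ 2 ≤ t * s` in the notation
  -- introduced below.
  have hquad : ∀ a : ℝ, 0 ≤ x ⬝ᵥ (T *ᵥ x) * (a * a) + 2 * (x ⬝ᵥ (Y *ᵥ x)) * a +
      x ⬝ᵥ (S *ᵥ x) := by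
    intro a
    have h := hblock.dotProduct_mulVec_nonneg (Sum.elim (a • x) x)
    simp [fromBlocks_mulVec, mulVec_smul, hyt] at h
    linarith
  have hdisc := discrim_le_zero hquad
  simp only [sub_mulVec, add_mulVec, smul_mulVec, one_mulVec, dotProduct_sub, dotProduct_add,
    dotProduct_smul, smul_eq_mul, star_trivial, hyt] at h1 h2 hdisc ⊢
  set N := x ⬝ᵥ x
  set s := x ⬝ᵥ (S *ᵥ x)
  set t := x ⬝ᵥ (T *ᵥ x)
  set y := x ⬝ᵥ (Y *ᵥ x)
  have hy : y ≤ √t * √s := by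
    rw [← Real.sqrt_mul' t hs0]
    refine Real.le_sqrt_of_sq_le ?_
    unfold discrim at hdisc
    linarith
  have ht0 : 0 ≤ t := by
    have h := hblock.dotProduct_mulVec_nonneg (Sum.elim x 0)
    simpa [fromBlocks_mulVec] using h
  -- Reverse triangle inequality: the left side is at most `s + t - 2 * y`, the form of the
  -- difference covariance at `x`.
  have hsq : (√s - √t) ^ 2 ≤ (θ * √N) ^ 2 := by
    have e1 := Real.sq_sqrt hs0
    have e2 := Real.sq_sqrt ht0
    have e3 := Real.sq_sqrt hx0
    nlinarith
  have hst : √s - √t ≤ θ * √N := le_of_abs_le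
    (abs_le_of_sq_le_sq hsq (mul_nonneg hθ (Real.sqrt_nonneg _)))
  have htN : √t ≤ √(lamMax T) * √N := by
    rw [← Real.sqrt_mul' _ hx0]
    exact Real.sqrt_le_sqrt h2
  have hsN : √s ≤ (√(lamMax T) + θ) * √N := by linarith
  have h := pow_le_pow_left₀ (Real.sqrt_nonneg s) hsN 2
  rw [mul_pow, Real.sq_sqrt hs0, Real.sq_sqrt hx0] at h
  unfold lamBar
  linarith

/-- Turning the matrix square root into a witness `P` makes the ball a projection of a set cut out
by closed polynomial conditions, so continuity of the root is not needed. -/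
theorem mem_ambiguity_iff_exists_sqrt :
    S ∈ ambiguity T θ ↔ 0 ≤ S ∧ lamMin T • (1 : Matrix (Fin n) (Fin n) ℝ) ≤ S ∧
      ∃ P, 0 ≤ P ∧ P * P = CFC.sqrt T * S * CFC.sqrt T ∧
        (S + T - (2 : ℝ) • P).trace ≤ θ ^ 2 := by
  have hR := CFC.sqrt_nonneg T
  have hRt := transpose_eq_of_nonneg hR
  constructor
  · rintro ⟨hS, hb, hl⟩
    have h0 : 0 ≤ CFC.sqrt T * S * CFC.sqrt T := by
      simpa only [hRt] using mul_mul_transpose_nonneg hS.nonneg (CFC.sqrt T)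
    exact ⟨hS.nonneg, hl, _, CFC.sqrt_nonneg _, CFC.sqrt_mul_sqrt_self _ h0, hb⟩
  · rintro ⟨hS, hl, P, hP, hPP, htr⟩
    refine ⟨hS.posSemidef, ?_, hl⟩
    rwa [buresSq, CFC.sqrt_unique hPP hP]

theorem self_mem_ambiguity (hT : 0 ≤ T) : T ∈ ambiguity T θ := by
  refine mem_ambiguity_iff_exists_sqrt.2
    ⟨hT, lamMin_smul_one_le hT.posSemidef.isHermitian, T, hT, ?_, ?_⟩
  · have h := CFC.sqrt_mul_sqrt_self T hT
    calc T * T = (CFC.sqrt T * CFC.sqrt T) * (CFC.sqrt T * CFC.sqrt T) := by rw [h]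
      _ = CFC.sqrt T * (CFC.sqrt T * CFC.sqrt T) * CFC.sqrt T := by simp only [Matrix.mul_assoc]
      _ = CFC.sqrt T * T * CFC.sqrt T := by rw [h]
  · rw [two_smul, sub_self, trace_zero]
    exact sq_nonneg θ

/-- The optimal coupling is `Y = R * P * R⁻¹` with `R` the root of `T`: its Schur complement
vanishes and its trace is that of `P`. -/
theorem exists_fromBlocks_of_mem_ambiguity (hT : T.PosDef) (hS : S ∈ ambiguity T θ) :
    ∃ Y, (fromBlocks T Y Yᵀ S).PosSemidef ∧ (S + T - (2 : ℝ) • Y).trace ≤ θ ^ 2 := by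
  have hT0 := hT.posSemidef.nonneg
  obtain ⟨-, -, P, hP, hPP, htr⟩ := mem_ambiguity_iff_exists_sqrt.1 hS
  have hRR := CFC.sqrt_mul_sqrt_self T hT0
  have hRt := transpose_eq_of_nonneg (CFC.sqrt_nonneg T)
  have hPt := transpose_eq_of_nonneg hP
  have hu : IsUnit (CFC.sqrt T) := (CFC.isUnit_sqrt_iff T hT0).2 hT.isUnit
  have hdet := (Matrix.isUnit_iff_isUnit_det _).1 hu
  set R := CFC.sqrt T
  refine ⟨R * P * R⁻¹, ?_, ?_⟩
  · let := hT.isUnit.invertible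
    have h := (PosDef.fromBlocks₁₁ (R * P * R⁻¹) S hT (A := T)).2
    rw [conjTranspose_eq_transpose_of_trivial] at h
    refine h ?_
    have hzero : S - (R * P * R⁻¹)ᵀ * T⁻¹ * (R * P * R⁻¹) = 0 := by
      have hinv : T⁻¹ = R⁻¹ * R⁻¹ := by rw [← hRR, Matrix.mul_inv_rev]
      rw [hinv, transpose_mul, transpose_mul, transpose_nonsing_inv, hRt, hPt, sub_eq_zero]
      have e : R⁻¹ * (P * R) * (R⁻¹ * R⁻¹) * (R * P * R⁻¹) = R⁻¹ * (P * P) * R⁻¹ := by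
        simp only [Matrix.mul_assoc, mul_nonsing_inv_cancel_left _ _ hdet,
          nonsing_inv_mul_cancel_left _ _ hdet]
      rw [e, hPP]
      simp only [Matrix.mul_assoc, nonsing_inv_mul_cancel_left _ _ hdet,
        mul_nonsing_inv _ hdet, Matrix.mul_one]
    rw [hzero]
    exact PosSemidef.zero
  · have h : (R * P * R⁻¹).trace = P.trace := by
      rw [Matrix.mul_assoc, trace_mul_comm, nonsing_inv_mul_cancel_right _ _ hdet]
    simpa only [trace_sub, trace_add, trace_smul, h] using htr

theorem le_lamBar_smul_one_of_mem_ambiguity (hT : T.PosDef) (hθ : 0 ≤ θ)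
    (hS : S ∈ ambiguity T θ) : S ≤ lamBar T θ • (1 : Matrix (Fin n) (Fin n) ℝ) := by
  obtain ⟨Y, hY, htr⟩ := exists_fromBlocks_of_mem_ambiguity hT hS
  exact le_lamBar_smul_one_of_fromBlocks hT.isHermitian hθ hY htr

theorem posDef_of_mem_ambiguity (hT : T.PosDef) (hS : S ∈ ambiguity T θ) : S.PosDef :=
  (lamMin_smul_one_posDef hT).of_le hS.2.2

/-- Expand `0 ≤ (P - 1) ^ 2`. This bounds the root witness by its square in the compactness proof.
-/
theorem le_half_mul_self_add_one {P : Matrix (Fin n) (Fin n) ℝ} (hP : 0 ≤ P) :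
    P ≤ (2⁻¹ : ℝ) • (P * P + 1) := by
  have hsq := (posSemidef_conjTranspose_mul_self (P - 1)).nonneg
  rw [conjTranspose_eq_transpose_of_trivial] at hsq
  rw [← sub_nonneg]
  refine le_of_le_of_eq (hsq.posSemidef.smul (by norm_num : (0 : ℝ) ≤ 2⁻¹)).nonneg ?_
  simp only [transpose_sub, transpose_eq_of_nonneg hP, transpose_one, Matrix.mul_sub,
    Matrix.sub_mul, Matrix.mul_one, Matrix.one_mul]
  module

theorem isCompact_ambiguity (hT : T.PosDef) (hθ : 0 ≤ θ) : IsCompact (ambiguity T θ) := by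
  have hT0 := hT.posSemidef.nonneg
  have hRt := transpose_eq_of_nonneg (CFC.sqrt_nonneg T)
  let K : Set (Matrix (Fin n) (Fin n) ℝ × Matrix (Fin n) (Fin n) ℝ) :=
    {p | (0 ≤ p.1 ∧ lamMin T • (1 : Matrix (Fin n) (Fin n) ℝ) ≤ p.1) ∧ 0 ≤ p.2 ∧
      p.2 * p.2 = CFC.sqrt T * p.1 * CFC.sqrt T ∧ (p.1 + T - (2 : ℝ) • p.2).trace ≤ θ ^ 2}
  have himage : ambiguity T θ = Prod.fst '' K := by
    ext S
    rw [mem_ambiguity_iff_exists_sqrt]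
    exact ⟨fun ⟨h1, h2, P, h3, h4, h5⟩ => ⟨(S, P), ⟨⟨h1, h2⟩, h3, h4, h5⟩, rfl⟩,
      fun ⟨⟨_, P⟩, ⟨⟨h1, h2⟩, h3, h4, h5⟩, e⟩ => by
        subst e
        exact ⟨h1, h2, P, h3, h4, h5⟩⟩
  rw [himage]
  refine IsCompact.image ?_ continuous_fst
  have hclosed : IsClosed K :=
    ((isClosed_le continuous_const continuous_fst).inter
      (isClosed_le continuous_const continuous_fst)).inter
      ((isClosed_le continuous_const continuous_snd).inter
        ((isClosed_eq (continuous_snd.mul continuous_snd)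
          ((continuous_const.mul continuous_fst).mul continuous_const)).inter
          (isClosed_le ((continuous_fst.add continuous_const).sub
            (continuous_snd.const_smul (2 : ℝ))).matrix_trace continuous_const)))
  refine ((isCompact_Icc (a := (0 : Matrix (Fin n) (Fin n) ℝ))
    (b := lamBar T θ • (1 : Matrix (Fin n) (Fin n) ℝ))).prod
    (isCompact_Icc (a := (0 : Matrix (Fin n) (Fin n) ℝ)) (b := (2⁻¹ : ℝ) • (CFC.sqrt T *
      lamBar T θ • (1 : Matrix (Fin n) (Fin n) ℝ) * CFC.sqrt T + 1)))).of_isClosed_subset hclosed ?_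
  rintro ⟨S, P⟩ ⟨⟨h1, h2⟩, h3, h4, h5⟩
  simp only at h1 h2 h3 h4 h5
  have hS := le_lamBar_smul_one_of_mem_ambiguity hT hθ
    (mem_ambiguity_iff_exists_sqrt.2 ⟨h1, h2, P, h3, h4, h5⟩)
  refine ⟨⟨h1, hS⟩, h3, ?_⟩
  refine (le_half_mul_self_add_one h3).trans (smul_mono_nonneg (add_le_add_left ?_ _) (by norm_num))
  rw [h4]
  simpa only [hRt] using mul_mul_transpose_mono hS (CFC.sqrt T)

end Ambiguity

/-! ### Comparison of steady states with the bounding filters. -/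

section Sandwich

variable {nx ny : ℕ} {A : Matrix (Fin nx) (Fin nx) ℝ} {C : Matrix (Fin ny) (Fin nx) ℝ}
  {Wl W Wu Lm Um Sm : Matrix (Fin nx) (Fin nx) ℝ} {Vl V Vu : Matrix (Fin ny) (Fin ny) ℝ}

/-- Start the upper filter at `Sm` itself: it stays above `Sm`, and it converges to `Um` from any
start. -/
theorem le_of_le_predict (hW : 0 ≤ W) (hV : V.PosDef) (hWu : W ≤ Wu) (hVu : V ≤ Vu)
    (hUm : ∀ X, 0 ≤ X → Tendsto (kfPrior A C Wu Vu X) atTop (𝓝 Um)) (hSm : 0 ≤ Sm)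
    (h : Sm ≤ predict A W (posterior C V Sm)) : Sm ≤ Um :=
  ge_of_tendsto' (hUm Sm hSm) fun t => (le_kfPrior_of_le_predict hV hSm h t).trans
    (kfPrior_mono hW hV hSm hWu hVu le_rfl t)

theorem le_of_predict_le (hWl : 0 ≤ Wl) (hVl : Vl.PosDef) (hW : Wl ≤ W) (hV : Vl ≤ V)
    (hLm : ∀ X, 0 ≤ X → Tendsto (kfPrior A C Wl Vl X) atTop (𝓝 Lm)) (hSm : 0 ≤ Sm)
    (h : predict A W (posterior C V Sm) ≤ Sm) : Lm ≤ Sm :=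
  le_of_tendsto' (hLm Sm hSm) fun t => (kfPrior_mono hWl hVl hSm hW hV le_rfl t).trans
    (kfPrior_le_of_predict_le (hWl.trans hW) (hVl.of_le hV) hSm h t)

theorem IsKFSteadyState.sandwiched {S : Matrix (Fin nx) (Fin nx) ℝ}
    (h : IsKFSteadyState A C W V Sm S) (hWl : 0 ≤ Wl) (hVl : Vl.PosDef) (hW : Wl ≤ W)
    (hV : Vl ≤ V) (hWu : W ≤ Wu) (hVu : V ≤ Vu) (hLm0 : 0 ≤ Lm)
    (hLm : ∀ X, 0 ≤ X → Tendsto (kfPrior A C Wl Vl X) atTop (𝓝 Lm))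
    (hUm : ∀ X, 0 ≤ X → Tendsto (kfPrior A C Wu Vu X) atTop (𝓝 Um)) :
    Sandwiched Lm (posterior C Vl Lm) Um (posterior C Vu Um) Sm S := by
  have hSm := h.posSemidef.nonneg
  have heq : Sm = predict A W (posterior C V Sm) := h.post ▸ h.prior
  have h1 := le_of_predict_le hWl hVl hW hV hLm hSm heq.ge
  have h2 := le_of_le_predict (hWl.trans hW) (hVl.of_le hV) hWu hVu hUm hSm heq.le
  rw [h.post]
  exact ⟨h1, h2, posterior_mono hLm0 hVl h1 hV, posterior_mono hSm (hVl.of_le hV) h2 hVu⟩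

theorem Sandwiched.of_mapClusterPt {ι : Type*} {l : Filter ι}
    {lm lp um up sm s : ι → Matrix (Fin nx) (Fin nx) ℝ} {L U : Matrix (Fin nx) (Fin nx) ℝ}
    {p : Matrix (Fin nx) (Fin nx) ℝ × Matrix (Fin nx) (Fin nx) ℝ}
    (h : ∀ t, Sandwiched (lm t) (lp t) (um t) (up t) (sm t) (s t))
    (hlm : Tendsto lm l (𝓝 Lm)) (hlp : Tendsto lp l (𝓝 L)) (hum : Tendsto um l (𝓝 Um))
    (hup : Tendsto up l (𝓝 U)) (hp : MapClusterPt p l fun t => (sm t, s t)) :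
    Sandwiched Lm L Um U p.1 p.2 := by
  obtain ⟨F, hF, hFp⟩ := mapClusterPt_iff_ultrafilter.1 hp
  have h1 : Tendsto sm F (𝓝 p.1) := (continuous_fst.tendsto p).comp hFp
  have h2 : Tendsto s F (𝓝 p.2) := (continuous_snd.tendsto p).comp hFp
  exact ⟨le_of_tendsto_of_tendsto' (hlm.mono_left hF) h1 fun t => (h t).1,
    le_of_tendsto_of_tendsto' h1 (hum.mono_left hF) fun t => (h t).2.1,
    le_of_tendsto_of_tendsto' (hlp.mono_left hF) h2 fun t => (h t).2.2.1,
    le_of_tendsto_of_tendsto' h2 (hup.mono_left hF) fun t => (h t).2.2.2⟩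

theorem exists_forall_le_of_tendsto {n : ℕ} {u : ℕ → Matrix (Fin n) (Fin n) ℝ}
    {X : Matrix (Fin n) (Fin n) ℝ} (h : Tendsto u atTop (𝓝 X)) (hu : ∀ t, 0 ≤ u t) :
    ∃ B, ∀ t, u t ≤ B := by
  have htr : Continuous fun X : Matrix (Fin n) (Fin n) ℝ => X.trace := by fun_prop
  obtain ⟨c, hc⟩ := ((htr.tendsto X).comp h).bddAbove_range
  exact ⟨c • 1, fun t => (le_trace_smul_one (hu t)).trans
    (smul_right_mono PosSemidef.one.nonneg (hc ⟨t, rfl⟩))⟩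

end Sandwich

namespace Model

variable {nx ny : ℕ} {M : Model nx ny}

/-! ### Existence and bounds for the robust filter. -/

section Filter

/-- Both balls are compact, and the eigenvalue floor keeps `V` positive definite, so the objective
is continuous there. -/
theorem exists_isStageMaximizer (hW : M.What.PosDef) (hV : M.Vhat.PosDef) (hθw : 0 ≤ M.θw)
    (hθv : 0 ≤ M.θv) {P : Matrix (Fin nx) (Fin nx) ℝ} (hP : 0 ≤ P) :
    ∃ W V, M.IsStageMaximizer P W V := by
  have hcont : ContinuousOn (fun q : Matrix (Fin nx) (Fin nx) ℝ × Matrix (Fin ny) (Fin ny) ℝ =>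
      (posterior M.C q.2 (predict M.A q.1 P)).trace)
      (ambiguity M.What M.θw ×ˢ ambiguity M.Vhat M.θv) := by
    rintro ⟨W, V⟩ ⟨h1, h2⟩
    have hpred : Continuous fun q : Matrix (Fin nx) (Fin nx) ℝ × Matrix (Fin ny) (Fin ny) ℝ =>
        (q.2, predict M.A q.1 P) := by
      unfold predict
      fun_prop
    have hpost := (continuousAt_posterior (C := M.C)
      (predict_nonneg (A := M.A) h1.1.nonneg hP) (posDef_of_mem_ambiguity hV h2)).comp
        (f := fun q : Matrix (Fin nx) (Fin nx) ℝ × Matrix (Fin ny) (Fin ny) ℝ =>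
          (q.2, predict M.A q.1 P)) (x := (W, V)) hpred.continuousAt
    have htr : Continuous fun X : Matrix (Fin nx) (Fin nx) ℝ => X.trace := by fun_prop
    exact (htr.continuousAt.comp hpost).continuousWithinAt
  obtain ⟨⟨W, V⟩, ⟨h1, h2⟩, hmax⟩ := ((isCompact_ambiguity hW hθw).prod
    (isCompact_ambiguity hV hθv)).exists_isMaxOn
      ⟨(M.What, M.Vhat), self_mem_ambiguity hW.posSemidef.nonneg,
        self_mem_ambiguity hV.posSemidef.nonneg⟩ hcont
  exact ⟨W, V, h1, h2, fun W' hW' V' hV' => hmax (Set.mk_mem_prod hW' hV')⟩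

/-- The initial problem is a stage problem with nominal process-noise covariance `Xhat` and
vanishing posterior covariance. -/
theorem exists_isInitMaximizer (hV : M.Vhat.PosDef) (hX : M.Xhat.PosDef) (hθv : 0 ≤ M.θv)
    (hθx : 0 ≤ M.θx) : ∃ Sm V, M.IsInitMaximizer Sm V := by
  obtain ⟨Sm, V, h⟩ := exists_isStageMaximizer (M := { M with What := M.Xhat, θw := M.θx })
    hX hV hθx hθv le_rfl
  simp only [IsStageMaximizer, predict, Matrix.mul_zero, Matrix.zero_mul, zero_add] at h
  exact ⟨Sm, V, h⟩

theorem exists_isRun (hW : M.What.PosDef) (hV : M.Vhat.PosDef) (hX : M.Xhat.PosDef)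
    (hθw : 0 ≤ M.θw) (hθv : 0 ≤ M.θv) (hθx : 0 ≤ M.θx) : ∃ Sm S W V, M.IsRun Sm S W V := by
  obtain ⟨Sm₀, V₀, h₀⟩ := exists_isInitMaximizer hV hX hθv hθx
  -- Maximizers are available only for `0 ≤ P`. The choice is made total with a dummy value, and the
  -- posteriors are later shown to be nonnegative.
  have hex : ∀ P, ∃ WV : Matrix (Fin nx) (Fin nx) ℝ × Matrix (Fin ny) (Fin ny) ℝ,
      0 ≤ P → M.IsStageMaximizer P WV.1 WV.2 := fun P => by
    by_cases hP : 0 ≤ P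
    · obtain ⟨W, V, h⟩ := exists_isStageMaximizer hW hV hθw hθv hP
      exact ⟨(W, V), fun _ => h⟩
    · exact ⟨0, fun h => absurd h hP⟩
  choose f hf using hex
  let S : ℕ → Matrix (Fin nx) (Fin nx) ℝ := fun t => Nat.rec (posterior M.C V₀ Sm₀)
    (fun _ P => posterior M.C (f P).2 (predict M.A (f P).1 P)) t
  have hS : ∀ t, 0 ≤ S t := by
    intro t
    induction t with
    | zero => exact posterior_nonneg h₀.1.1.nonneg (posDef_of_mem_ambiguity hV h₀.2.1)
    | succ t ih =>
      exact posterior_nonneg (predict_nonneg (hf _ ih).1.1.nonneg ih)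
        (posDef_of_mem_ambiguity hV (hf _ ih).2.1)
  let Sm : ℕ → Matrix (Fin nx) (Fin nx) ℝ := fun t =>
    Nat.casesOn t Sm₀ fun k => predict M.A (f (S k)).1 (S k)
  let V : ℕ → Matrix (Fin ny) (Fin ny) ℝ := fun t => Nat.casesOn t V₀ fun k => (f (S k)).2
  refine ⟨Sm, S, fun t => (f (S t)).1, V, h₀, fun t => hf _ (hS t), fun t => ?_, fun t => rfl⟩
  cases t <;> rfl

theorem IsRun.sandwiched (hW : M.What.PosDef) (hV : M.Vhat.PosDef) (hX : M.Xhat.PosDef)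
    (hθw : 0 ≤ M.θw) (hθv : 0 ≤ M.θv) (hθx : 0 ≤ M.θx)
    {Sm S W : ℕ → Matrix (Fin nx) (Fin nx) ℝ} {V : ℕ → Matrix (Fin ny) (Fin ny) ℝ}
    (h : M.IsRun Sm S W V) (t : ℕ) :
    Sandwiched (M.lowPrior t) (M.lowPost t) (M.upPrior t) (M.upPost t) (Sm t) (S t) := by
  have hWl := (lamMin_smul_one_posDef hW).posSemidef.nonneg
  have hVl := lamMin_smul_one_posDef hV
  have hXl := (lamMin_smul_one_posDef hX).posSemidef.nonneg
  have hVt : ∀ t, V t ∈ ambiguity M.Vhat M.θv := fun t => by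
    cases t with
    | zero => exact h.init.2.1
    | succ t => exact (h.stage t).2.1
  have hpost : ∀ t, M.lowPrior t ≤ Sm t → Sm t ≤ M.upPrior t →
      M.lowPost t ≤ S t ∧ S t ≤ M.upPost t := fun t h1 h2 => by
    have hl : 0 ≤ M.lowPrior t := kfPrior_nonneg hWl hVl hXl t
    rw [h.post t]
    exact ⟨posterior_mono hl hVl h1 (hVt t).2.2,
      posterior_mono (hl.trans h1) (posDef_of_mem_ambiguity hV (hVt t)) h2
        (le_lamBar_smul_one_of_mem_ambiguity hV hθv (hVt t))⟩
  have hprior : M.lowPrior t ≤ Sm t ∧ Sm t ≤ M.upPrior t := by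
    induction t with
    | zero =>
      exact ⟨h.init.1.2.2, le_lamBar_smul_one_of_mem_ambiguity hX hθx h.init.1⟩
    | succ t ih =>
      obtain ⟨h1, h2⟩ := hpost t ih.1 ih.2
      rw [h.prior t]
      exact ⟨predict_mono (h.stage t).1.2.2 h1,
        predict_mono (le_lamBar_smul_one_of_mem_ambiguity hW hθw (h.stage t).1) h2⟩
  exact ⟨hprior.1, hprior.2, hpost t hprior.1 hprior.2⟩

theorem IsRun.exists_mapClusterPt (hW : M.What.PosDef) (hV : M.Vhat.PosDef) (hX : M.Xhat.PosDef)
    (hθw : 0 ≤ M.θw) (hθv : 0 ≤ M.θv) (hθx : 0 ≤ M.θx)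
    {Sm S W : ℕ → Matrix (Fin nx) (Fin nx) ℝ} {V : ℕ → Matrix (Fin ny) (Fin ny) ℝ}
    (h : M.IsRun Sm S W V) {Um U : Matrix (Fin nx) (Fin nx) ℝ}
    (hUm : Tendsto M.upPrior atTop (𝓝 Um)) (hU : Tendsto M.upPost atTop (𝓝 U)) :
    ∃ p, MapClusterPt p atTop fun t => (Sm t, S t) := by
  have hWl := (lamMin_smul_one_posDef hW).posSemidef.nonneg
  have hVl := lamMin_smul_one_posDef hV
  have hXl := (lamMin_smul_one_posDef hX).posSemidef.nonneg
  have hl : ∀ t, 0 ≤ M.lowPrior t := kfPrior_nonneg hWl hVl hXl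
  have hs := h.sandwiched hW hV hX hθw hθv hθx
  have hlp : ∀ t, 0 ≤ M.lowPost t := fun t => posterior_nonneg (hl t) hVl
  obtain ⟨B, hB⟩ := exists_forall_le_of_tendsto hUm fun t =>
    (hl t).trans ((hs t).1.trans (hs t).2.1)
  obtain ⟨D, hD⟩ := exists_forall_le_of_tendsto hU fun t =>
    (hlp t).trans ((hs t).2.2.1.trans (hs t).2.2.2)
  obtain ⟨p, -, hp⟩ := ((isCompact_Icc (a := 0) (b := B)).prod
    (isCompact_Icc (a := 0) (b := D))).exists_mapClusterPt (f := atTop)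
      (u := fun t => (Sm t, S t)) (tendsto_principal.2 (Eventually.of_forall fun t =>
        ⟨⟨(hl t).trans (hs t).1, (hs t).2.1.trans (hB t)⟩,
          (hlp t).trans (hs t).2.2.1, (hs t).2.2.2.trans (hD t)⟩))
  exact ⟨p, hp⟩

end Filter

/-! ### The stationary semidefinite program. -/

section SDP

variable {Sm S W Y : Matrix (Fin nx) (Fin nx) ℝ} {V Z : Matrix (Fin ny) (Fin ny) ℝ}

/-- Schur complement with respect to the positive definite innovation block. -/
theorem fromBlocks_posSemidef_iff_le_posterior (C : Matrix (Fin ny) (Fin nx) ℝ) (hSm : 0 ≤ Sm)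
    (hV : V.PosDef) :
    (fromBlocks (Sm - S) (Sm * Cᵀ) (C * Sm) (C * Sm * Cᵀ + V)).PosSemidef ↔
      S ≤ posterior C V Sm := by
  have hM := innovation_posDef (C := C) hSm hV
  let := hM.isUnit.invertible
  have h := PosDef.fromBlocks₂₂ (Sm - S) (Sm * Cᵀ) hM
  have ht : (Sm * Cᵀ)ᴴ = C * Sm := by
    rw [conjTranspose_eq_transpose_of_trivial, transpose_mul, transpose_transpose,
      transpose_eq_of_nonneg hSm]
  rw [ht] at h
  rw [h, le_iff, posterior, ← Matrix.mul_assoc, sub_right_comm]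

theorem SDPFeasible.posDef (hV : M.Vhat.PosDef) (h : M.SDPFeasible Sm S W V Y Z) : V.PosDef :=
  (lamMin_smul_one_posDef hV).of_le h.lowerV

theorem SDPFeasible.le_posterior (hV : M.Vhat.PosDef) (h : M.SDPFeasible Sm S W V Y Z) :
    S ≤ posterior M.C V Sm :=
  (fromBlocks_posSemidef_iff_le_posterior M.C h.psdSm.nonneg (h.posDef hV)).1 h.lmi

theorem SDPFeasible.le_predict (hV : M.Vhat.PosDef) (h : M.SDPFeasible Sm S W V Y Z) :
    Sm ≤ predict M.A W (posterior M.C V Sm) :=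
  h.prior.le.trans (predict_mono le_rfl (h.le_posterior hV))

/-- Replacing the posterior block by the measurement update of the prior block preserves
feasibility. -/
theorem SDPFeasible.update (hV : M.Vhat.PosDef) (h : M.SDPFeasible Sm S W V Y Z) :
    M.SDPFeasible (predict M.A W (posterior M.C V Sm)) (posterior M.C V Sm) W V Y Z := by
  have hVd := h.posDef hV
  have hpost := posterior_nonneg (C := M.C) h.psdSm.nonneg hVd
  have hpred := predict_nonneg (A := M.A) h.psdW.nonneg hpost
  exact { h with
    lmi := (fromBlocks_posSemidef_iff_le_posterior M.C hpred hVd).2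
      (posterior_mono h.psdSm.nonneg hVd (h.le_predict hV) le_rfl)
    prior := rfl
    psdSm := hpred.posSemidef
    psdS := hpost.posSemidef }

/-- The updated point is feasible and its posterior dominates `S`. Optimality forces equal traces,
and a positive semidefinite difference of trace zero vanishes. -/
theorem IsSDPSolution.exists_isKFSteadyState (hV : M.Vhat.PosDef) (h : M.IsSDPSolution Sm S) :
    ∃ W V Y Z, M.SDPFeasible Sm S W V Y Z ∧ IsKFSteadyState M.A M.C W V Sm S := by
  obtain ⟨W, V, Y, Z, hf, hmax⟩ := h
  have hle := hf.le_posterior hV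
  have htr := hmax _ _ _ _ _ _ (hf.update hV)
  have hzero : (posterior M.C V Sm - S).trace = 0 :=
    le_antisymm (by rw [trace_sub]; linarith) (le_iff.1 hle).trace_nonneg
  have heq := sub_eq_zero.1 ((le_iff.1 hle).trace_eq_zero_iff.1 hzero)
  exact ⟨W, V, Y, Z, hf, hf.psdSm, heq.symm, hf.prior⟩

theorem SDPFeasible.le_lamBar_process (hW : M.What.PosDef) (hθw : 0 ≤ M.θw)
    (h : M.SDPFeasible Sm S W V Y Z) : W ≤ lamBar M.What M.θw • 1 :=
  le_lamBar_smul_one_of_fromBlocks hW.isHermitian hθw h.lmiW h.traceW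

theorem SDPFeasible.le_lamBar_measurement (hV : M.Vhat.PosDef) (hθv : 0 ≤ M.θv)
    (h : M.SDPFeasible Sm S W V Y Z) : V ≤ lamBar M.Vhat M.θv • 1 :=
  le_lamBar_smul_one_of_fromBlocks hV.isHermitian hθv h.lmiV h.traceV

theorem fromBlocks_self_posSemidef {n : ℕ} {T : Matrix (Fin n) (Fin n) ℝ} (hT : T.PosDef) :
    (fromBlocks T T Tᵀ T).PosSemidef := by
  let := hT.isUnit.invertible
  have h := (PosDef.fromBlocks₁₁ T T hT).2
  rw [conjTranspose_eq_transpose_of_trivial] at h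
  refine h ?_
  rw [transpose_eq_of_nonneg hT.posSemidef.nonneg, mul_inv_of_invertible, Matrix.one_mul, sub_self]
  exact PosSemidef.zero

theorem sdpFeasible_nominal (hW : M.What.PosDef) (hV : M.Vhat.PosDef) :
    M.SDPFeasible M.What 0 M.What M.Vhat M.What M.Vhat where
  lmi := (fromBlocks_posSemidef_iff_le_posterior M.C hW.posSemidef.nonneg hV).2
    (posterior_nonneg hW.posSemidef.nonneg hV)
  lmiW := fromBlocks_self_posSemidef hW
  lmiV := fromBlocks_self_posSemidef hV
  prior := by simp [predict]
  traceW := by rw [two_smul, sub_self, trace_zero]; exact sq_nonneg _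
  traceV := by rw [two_smul, sub_self, trace_zero]; exact sq_nonneg _
  lowerW := lamMin_smul_one_le hW.isHermitian
  lowerV := lamMin_smul_one_le hV.isHermitian
  psdSm := hW.posSemidef
  psdS := PosSemidef.zero
  psdW := hW.posSemidef
  psdV := hV.posSemidef

/-- `Y` need not be symmetric, so it is confined entrywise rather than to a Loewner interval. -/
theorem apply_mem_Icc_of_fromBlocks {n : ℕ} {T S Y B : Matrix (Fin n) (Fin n) ℝ}
    (h : (fromBlocks T Y Yᵀ S).PosSemidef) (hS : S ≤ B) (i j : Fin n) :
    Y i j ∈ Set.Icc (-((T i i + B j j) / 2)) ((T i i + B j j) / 2) := by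
  have h1 := abs_le.1 (h.abs_apply_le (Sum.inl i) (Sum.inr j))
  have h2 := (le_iff.1 hS).diag_nonneg (i := j)
  simp only [fromBlocks_apply₁₁, fromBlocks_apply₁₂, fromBlocks_apply₂₂, Matrix.sub_apply] at h1 h2
  constructor <;> linarith

variable (M) in
/-- The feasible set of the stationary semidefinite program. -/
def sdpFeasibleSet : Set ((Matrix (Fin nx) (Fin nx) ℝ × Matrix (Fin nx) (Fin nx) ℝ) ×
    (Matrix (Fin nx) (Fin nx) ℝ × Matrix (Fin ny) (Fin ny) ℝ) ×
    (Matrix (Fin nx) (Fin nx) ℝ × Matrix (Fin ny) (Fin ny) ℝ)) :=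
  {p | M.SDPFeasible p.1.1 p.1.2 p.2.1.1 p.2.1.2 p.2.2.1 p.2.2.2}

theorem isClosed_sdpFeasibleSet : IsClosed M.sdpFeasibleSet := by
  let E := (Matrix (Fin nx) (Fin nx) ℝ × Matrix (Fin nx) (Fin nx) ℝ) ×
    (Matrix (Fin nx) (Fin nx) ℝ × Matrix (Fin ny) (Fin ny) ℝ) ×
    (Matrix (Fin nx) (Fin nx) ℝ × Matrix (Fin ny) (Fin ny) ℝ)
  have c1 : Continuous fun p : E => p.1.1 := by fun_prop
  have c2 : Continuous fun p : E => p.1.2 := by fun_prop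
  have c3 : Continuous fun p : E => p.2.1.1 := by fun_prop
  have c4 : Continuous fun p : E => p.2.1.2 := by fun_prop
  have c5 : Continuous fun p : E => p.2.2.1 := by fun_prop
  have c6 : Continuous fun p : E => p.2.2.2 := by fun_prop
  have d1 : Continuous fun p : E => fromBlocks (p.1.1 - p.1.2) (p.1.1 * M.Cᵀ) (M.C * p.1.1)
      (M.C * p.1.1 * M.Cᵀ + p.2.1.2) :=
    (c1.sub c2).matrix_fromBlocks (c1.matrix_mul continuous_const)
      (continuous_const.matrix_mul c1)
      (((continuous_const.matrix_mul c1).matrix_mul continuous_const).add c4)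
  have d2 : Continuous fun p : E => fromBlocks M.What p.2.2.1 p.2.2.1ᵀ p.2.1.1 :=
    continuous_const.matrix_fromBlocks c5 c5.matrix_transpose c3
  have d3 : Continuous fun p : E => fromBlocks M.Vhat p.2.2.2 p.2.2.2ᵀ p.2.1.2 :=
    continuous_const.matrix_fromBlocks c6 c6.matrix_transpose c4
  have d4 : Continuous fun p : E => predict M.A p.2.1.1 p.1.2 :=
    ((continuous_const.matrix_mul c2).matrix_mul continuous_const).add c3
  have d5 : Continuous fun p : E => (p.2.1.1 + M.What - (2 : ℝ) • p.2.2.1).trace :=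
    ((c3.add continuous_const).sub (c5.const_smul (2 : ℝ))).matrix_trace
  have d6 : Continuous fun p : E => (p.2.1.2 + M.Vhat - (2 : ℝ) • p.2.2.2).trace :=
    ((c4.add continuous_const).sub (c6.const_smul (2 : ℝ))).matrix_trace
  have k1 := (isClosed_setOf_posSemidef.preimage d1).inter
    ((isClosed_setOf_posSemidef.preimage d2).inter (isClosed_setOf_posSemidef.preimage d3))
  have k2 := (isClosed_eq c1 d4).inter ((isClosed_le d5 (continuous_const (y := M.θw ^ 2))).inter
    (isClosed_le d6 (continuous_const (y := M.θv ^ 2))))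
  have k3 := (isClosed_le (continuous_const (y := lamMin M.What • 1)) c3).inter
    (isClosed_le (continuous_const (y := lamMin M.Vhat • 1)) c4)
  have k4 := ((isClosed_setOf_posSemidef.preimage c1).inter
    (isClosed_setOf_posSemidef.preimage c2)).inter
    ((isClosed_setOf_posSemidef.preimage c3).inter (isClosed_setOf_posSemidef.preimage c4))
  convert! (k1.inter k2).inter (k3.inter k4) using 1
  ext p
  exact ⟨fun h => ⟨⟨⟨h.lmi, h.lmiW, h.lmiV⟩, h.prior, h.traceW, h.traceV⟩,
      ⟨h.lowerW, h.lowerV⟩, ⟨h.psdSm, h.psdS⟩, h.psdW, h.psdV⟩,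
    fun ⟨⟨⟨h1, h2, h3⟩, h4, h5, h6⟩, ⟨h7, h8⟩, ⟨h9, h10⟩, h11, h12⟩ =>
      ⟨h1, h2, h3, h4, h5, h6, h7, h8, h9, h10, h11, h12⟩⟩

/-- The crucial bound is on the prior: a feasible prior is a subsolution of the upper Riccati
recursion, hence lies below `Um`. -/
theorem isCompact_sdpFeasibleSet (hW : M.What.PosDef) (hV : M.Vhat.PosDef) (hθw : 0 ≤ M.θw)
    (hθv : 0 ≤ M.θv) {Um : Matrix (Fin nx) (Fin nx) ℝ}
    (hUm : ∀ X, 0 ≤ X → Tendsto (kfPrior M.A M.C (lamBar M.What M.θw • 1)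
      (lamBar M.Vhat M.θv • 1) X) atTop (𝓝 Um)) : IsCompact M.sdpFeasibleSet := by
  let Wu : Matrix (Fin nx) (Fin nx) ℝ := lamBar M.What M.θw • 1
  let Vu : Matrix (Fin ny) (Fin ny) ℝ := lamBar M.Vhat M.θv • 1
  have hK := ((isCompact_Icc (a := 0) (b := Um)).prod
    (isCompact_Icc (a := 0) (b := posterior M.C Vu Um))).prod
    (((isCompact_Icc (a := 0) (b := Wu)).prod (isCompact_Icc (a := 0) (b := Vu))).prod
    ((isCompact_setOf_entries_mem_Icc
      (of fun i j => -((M.What i i + Wu j j) / 2)) (of fun i j => (M.What i i + Wu j j) / 2)).prod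
    (isCompact_setOf_entries_mem_Icc
      (of fun i j => -((M.Vhat i i + Vu j j) / 2)) (of fun i j => (M.Vhat i i + Vu j j) / 2))))
  refine hK.of_isClosed_subset isClosed_sdpFeasibleSet ?_
  rintro ⟨⟨Sm, S⟩, ⟨W, V⟩, Y, Z⟩ (h : M.SDPFeasible Sm S W V Y Z)
  have hWu := h.le_lamBar_process hW hθw
  have hVu := h.le_lamBar_measurement hV hθv
  have hVd := h.posDef hV
  have hSm := le_of_le_predict h.psdW.nonneg hVd hWu hVu hUm h.psdSm.nonneg (h.le_predict hV)
  exact ⟨⟨⟨h.psdSm.nonneg, hSm⟩, h.psdS.nonneg,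
      (h.le_posterior hV).trans (posterior_mono h.psdSm.nonneg hVd hSm hVu)⟩,
    ⟨⟨h.psdW.nonneg, hWu⟩, h.psdV.nonneg, hVu⟩,
    apply_mem_Icc_of_fromBlocks h.lmiW hWu, apply_mem_Icc_of_fromBlocks h.lmiV hVu⟩

theorem exists_isSDPSolution (hW : M.What.PosDef) (hV : M.Vhat.PosDef) (hθw : 0 ≤ M.θw)
    (hθv : 0 ≤ M.θv) {Um : Matrix (Fin nx) (Fin nx) ℝ}
    (hUm : ∀ X, 0 ≤ X → Tendsto (kfPrior M.A M.C (lamBar M.What M.θw • 1)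
      (lamBar M.Vhat M.θv • 1) X) atTop (𝓝 Um)) : ∃ Sm S, M.IsSDPSolution Sm S := by
  have hcont : Continuous fun p : (Matrix (Fin nx) (Fin nx) ℝ × Matrix (Fin nx) (Fin nx) ℝ) ×
    (Matrix (Fin nx) (Fin nx) ℝ × Matrix (Fin ny) (Fin ny) ℝ) ×
    (Matrix (Fin nx) (Fin nx) ℝ × Matrix (Fin ny) (Fin ny) ℝ) => p.1.2.trace := by fun_prop
  obtain ⟨⟨⟨Sm, S⟩, ⟨W, V⟩, Y, Z⟩, hf, hmax⟩ :=
    (isCompact_sdpFeasibleSet hW hV hθw hθv hUm).exists_isMaxOn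
      ⟨((M.What, 0), (M.What, M.Vhat), (M.What, M.Vhat)), sdpFeasible_nominal hW hV⟩
      hcont.continuousOn
  exact ⟨Sm, S, W, V, Y, Z, hf, fun Sm' S' W' V' Y' Z' hf' =>
    hmax (show ((Sm', S'), (W', V'), (Y', Z')) ∈ M.sdpFeasibleSet from hf')⟩

end SDP

end Model

end DRKF

open DRKF DRKF.Model

theorem mainTheorem9 {nx ny : ℕ} (M : DRKF.Model nx ny)
    (hW : M.What.PosDef) (hV : M.Vhat.PosDef) (hX : M.Xhat.PosDef)
    (hθw : 0 ≤ M.θw) (hθv : 0 ≤ M.θv) (hθx : 0 ≤ M.θx)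
    (hobs : DRKF.Observable M.A M.C) :
    ∃ Lm L Um U : Matrix (Fin nx) (Fin nx) ℝ,
      -- the lower- and upper-bound Kalman filters converge
      (Tendsto M.lowPrior atTop (𝓝 Lm) ∧ Tendsto M.lowPost atTop (𝓝 L) ∧
        Tendsto M.upPrior atTop (𝓝 Um) ∧ Tendsto M.upPost atTop (𝓝 U)) ∧
      -- their limits are their unique steady states
      (∀ Sm S, DRKF.IsKFSteadyState M.A M.C (DRKF.lamMin M.What • 1) (DRKF.lamMin M.Vhat • 1) Sm S ↔
        Sm = Lm ∧ S = L) ∧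
      (∀ Sm S, DRKF.IsKFSteadyState M.A M.C (DRKF.lamBar M.What M.θw • 1)
        (DRKF.lamBar M.Vhat M.θv • 1) Sm S ↔ Sm = Um ∧ S = U) ∧
      -- a robust filter exists
      (∃ Sm S W V, M.IsRun Sm S W V) ∧
      -- limits of the robust filter covariances
      (∀ Sm S W V, M.IsRun Sm S W V → ∀ Sm' S', Tendsto Sm atTop (𝓝 Sm') →
        Tendsto S atTop (𝓝 S') → DRKF.Sandwiched Lm L Um U Sm' S') ∧
      -- accumulation points of the robust filter covariances, which always exist
      (∀ Sm S W V, M.IsRun Sm S W V →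
        (∃ p, MapClusterPt p atTop fun t => (Sm t, S t)) ∧
        ∀ p, MapClusterPt p atTop (fun t => (Sm t, S t)) →
          DRKF.Sandwiched Lm L Um U p.1 p.2) ∧
      -- fixed points of the robust Riccati recursion
      (∀ Sm S, M.IsFixedPoint Sm S → DRKF.Sandwiched Lm L Um U Sm S) ∧
      -- optimal solutions of the stationary semidefinite program, which always exist
      (∃ Sm S, M.IsSDPSolution Sm S) ∧
      (∀ Sm S, M.IsSDPSolution Sm S → DRKF.Sandwiched Lm L Um U Sm S) := by
  have hWl := lamMin_smul_one_posDef hW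
  have hVl := lamMin_smul_one_posDef hV
  have hXl := lamMin_smul_one_posDef hX
  -- The nominal covariance belongs to its own ball, so it lies between the two multiples of the
  -- identity and the upper one is positive definite.
  have hWu := hWl.of_le ((lamMin_smul_one_le hW.isHermitian).trans
    (le_lamBar_smul_one_of_mem_ambiguity hW hθw (self_mem_ambiguity hW.posSemidef.nonneg)))
  have hVu := hVl.of_le ((lamMin_smul_one_le hV.isHermitian).trans
    (le_lamBar_smul_one_of_mem_ambiguity hV hθv (self_mem_ambiguity hV.posSemidef.nonneg)))
  have hXu := hXl.of_le ((lamMin_smul_one_le hX.isHermitian).trans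
    (le_lamBar_smul_one_of_mem_ambiguity hX hθx (self_mem_ambiguity hX.posSemidef.nonneg)))
  obtain ⟨Lm, hLm0, hLm⟩ := exists_forall_tendsto_kfPrior hobs hWl hVl
  obtain ⟨Um, hUm0, hUm⟩ := exists_forall_tendsto_kfPrior hobs hWu hVu
  have tlow : Tendsto M.lowPrior atTop (𝓝 Lm) := hLm _ hXl.posSemidef.nonneg
  have tup : Tendsto M.upPrior atTop (𝓝 Um) := hUm _ hXu.posSemidef.nonneg
  have tlowp : Tendsto M.lowPost atTop (𝓝 (posterior M.C (lamMin M.Vhat • 1) Lm)) :=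
    tendsto_posterior hVl hLm0 tlow
  have tupp : Tendsto M.upPost atTop (𝓝 (posterior M.C (lamBar M.Vhat M.θv • 1) Um)) :=
    tendsto_posterior hVu hUm0 tup
  have hcluster : ∀ Sm S W V, M.IsRun Sm S W V → ∀ p,
      MapClusterPt p atTop (fun t => (Sm t, S t)) → Sandwiched Lm _ Um _ p.1 p.2 :=
    fun Sm S W V h p hp => Sandwiched.of_mapClusterPt
      (h.sandwiched hW hV hX hθw hθv hθx) tlow tlowp tup tupp hp
  refine ⟨Lm, _, Um, _, ⟨tlow, tlowp, tup, tupp⟩, isKFSteadyState_iff hVl hLm0 hLm,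
    isKFSteadyState_iff hVu hUm0 hUm, exists_isRun hW hV hX hθw hθv hθx, ?_, ?_, ?_,
    exists_isSDPSolution hW hV hθw hθv hUm, ?_⟩
  · exact fun Sm S W V h Sm' S' hSm hS =>
      hcluster Sm S W V h (Sm', S') (hSm.prodMk_nhds hS).mapClusterPt
  · exact fun Sm S W V h =>
      ⟨h.exists_mapClusterPt hW hV hX hθw hθv hθx tup tupp, hcluster Sm S W V h⟩
  -- Admissibility of `W` and `V` suffices; their maximality plays no role in the bounds.
  · rintro Sm S ⟨hSm, W, V, ⟨hWm, hVm, -⟩, hpost, hprior⟩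
    exact IsKFSteadyState.sandwiched ⟨hSm, hpost, hprior⟩ hWl.posSemidef.nonneg hVl hWm.2.2
      hVm.2.2 (le_lamBar_smul_one_of_mem_ambiguity hW hθw hWm)
      (le_lamBar_smul_one_of_mem_ambiguity hV hθv hVm) hLm0 hLm hUm
  · intro Sm S h
    obtain ⟨W, V, Y, Z, hf, hs⟩ := h.exists_isKFSteadyState hV
    exact hs.sandwiched hWl.posSemidef.nonneg hVl hf.lowerW hf.lowerV
      (hf.le_lamBar_process hW hθw) (hf.le_lamBar_measurement hV hθv) hLm0 hLm hUm
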